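/- Let $\Omega\subset\mathbb{R}^d$ be open, $\alpha>0$, $\beta\in\mathbb{R}$, and for $\boldsymbol m,\boldsymbol v\in\mathbb{R}^3$ let $$P(\boldsymbol m)\boldsymbol v=\alpha\Big(\boldsymbol v-\frac{\boldsymbol m\cdot\boldsymbol v}{|\boldsymbol m|^2}\boldsymbol m\Big)+\beta\,\boldsymbol m\times\boldsymbol v ,\qquad P(\boldsymbol 0)\boldsymbol v=\alpha\boldsymbol v .$$ Let $A=(a_{ij})$, $D=(d_{ij})$ be real lower triangular $s\times s$ matrices with $a_{ii},d_{ii}>0$ and $\sum_{j=1}^i d_{ij}=1$ for all $i$, let $b\in\mathbb{R}^s$ and $B=\mathrm{diag}(b)$, and let $J$ be the $s\times s$ shift matrix, $J_{ij}=1$ if $i=j+1$ and $J_{ij}=0$ otherwise. Let $\tau>0$. One step of the product-type IMEX-RK (PRK) projection scheme for the gradient flow $\boldsymbol m_t=P(\boldsymbol m)\Delta\boldsymbol m$ of the Dirichlet energy $E[\boldsymbol m]=\int_\Omega\frac12|\nabla\boldsymbol m|^2\,\mathrm d\boldsymbol x$ is $$\boldsymbol u_0=\boldsymbol m^n,\qquad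 \boldsymbol u_i=\boldsymbol u_0+\tau\sum_{j=1}^i a_{ij}P(\boldsymbol u_{j-1})\sum_{k=1}^j d_{jk}\Delta\boldsymbol u_k\quad(i=1,\dots,s),$$ $$\tilde{\boldsymbol m}^{n+1}=\boldsymbol u_0+\tau\sum_{j=1}^s b_jP(\boldsymbol u_{j-1})\sum_{k=1}^j d_{jk}\Delta\boldsymbol u_k,\qquad \boldsymbol m^{n+1}=\frac{\tilde{\boldsymbol m}^{n+1}}{|\tilde{\boldsymbol m}^{n+1}|}\qquad\text{a.e. in }\Omega.$$ Here $\boldsymbol m^n:\Omega\to\mathbb{R}^3$ has a weak gradient in $L^2(\Omega)$ and satisfies $|\boldsymbol m^n|=1$ a.e.; the stages satisfy $\boldsymbol u_i-\boldsymbol m^n\in H^1(\Omega;\mathbb{R}^3)$ and have weak Laplacians $\Delta\boldsymbol u_i\in L^2(\Omega;\mathbb{R}^3)$ for $i=1,\dots,s$; and they satisfy one of the following boundary conditions: (Dirichlet, time-independent) $\boldsymbol u_i=\boldsymbol m^n$ on $\partial\Omega$, i.e. $\boldsymbol u_i-\boldsymbol m^n\in H^1_0(\Omega;\mathbb{R}^3)$,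 for $i=1,\dots,s$; or (homogeneous Neumann) $\partial_\nu\boldsymbol u_i=0$ on $\partial\Omega$ in the weak sense, i.e. $\int_\Omega\nabla\boldsymbol u_i:\nabla\boldsymbol v\,\mathrm d\boldsymbol x=-\int_\Omega\Delta\boldsymbol u_i\cdot\boldsymbol v\,\mathrm d\boldsymbol x$ for all $\boldsymbol v\in H^1(\Omega;\mathbb{R}^3)$, for $i=1,\dots,s$. Assume that $b_i\ge 0$ for all $i$ and that the matrices $$Q=BDA+(BDA)^\top-bb^\top,\qquad R=bb^\top-BJA-(BJA)^\top$$ are positive semidefinite. Then $|\boldsymbol m^{n+1}|=1$ a.e. in $\Omega$, $\boldsymbol m^{n+1}$ has a weak gradient in $L^2(\Omega)$, and $$\int_\Omega\tfrac12|\nabla\boldsymbol m^{n+1}|^2\,\mathrm d\boldsymbol x\le\int_\Omega\tfrac12|\nabla\boldsymbol m^{n}|^2\,\mathrm d\boldsymbol x .$$ Moreover, before projection, $|\tilde{\boldsymbol m}^{n+1}|\ge1$ a.e. in $\Omega$, $\tilde{\boldsymbol m}^{n+1}$ has a weak gradient in $L^2(\Omega)$, and $\int_\Omega\frac12|\nabla\tilde{\boldsymbol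 m}^{n+1}|^2\,\mathrm d\boldsymbol x\le\int_\Omega\frac12|\nabla\boldsymbol m^{n}|^2\,\mathrm d\boldsymbol x$. -/

import Mathlib

open MeasureTheory Filter Topology

/-- The space `ℝ³` in which the vector fields take their values. -/
abbrev R3 : Type := EuclideanSpace ℝ (Fin 3)

section Sobolev

variable {d : ℕ}

/-- The `k`-th classical partial derivative. -/
noncomputable def partialD {F : Type*} [NormedAddCommGroup F] [NormedSpace ℝ F] (k : Fin d)
    (φ : EuclideanSpace ℝ (Fin d) → F) (x : EuclideanSpace ℝ (Fin d)) : F :=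
  fderiv ℝ φ x (EuclideanSpace.single k 1)

/-- `φ ∈ C_c^∞(Ω; F)`, regarded as a function on the whole space. -/
structure IsTestFunction {F : Type*} [NormedAddCommGroup F] [NormedSpace ℝ F]
    (Ω : Set (EuclideanSpace ℝ (Fin d))) (φ : EuclideanSpace ℝ (Fin d) → F) : Prop where
  smooth : ContDiff ℝ (⊤ : ℕ∞) φ
  compact : HasCompactSupport φ
  supp : tsupport φ ⊆ Ω

/-- `G k` is the weak (distributional) derivative `∂_k u` on `Ω`, for every `k`. -/
structure IsWeakGrad (Ω : Set (EuclideanSpace ℝ (Fin d)))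
    (u : EuclideanSpace ℝ (Fin d) → R3) (G : Fin d → EuclideanSpace ℝ (Fin d) → R3) : Prop where
  locInt : LocallyIntegrableOn u Ω
  locInt_grad : ∀ k, LocallyIntegrableOn (G k) Ω
  parts : ∀ (k : Fin d) (φ : EuclideanSpace ℝ (Fin d) → ℝ), IsTestFunction Ω φ →
    ∫ x in Ω, partialD k φ x • u x = - ∫ x in Ω, φ x • G k x

/-- `u` has a weak gradient in `L²(Ω)`. -/
def HasFiniteDirichletEnergy (Ω : Set (EuclideanSpace ℝ (Fin d)))
    (u : EuclideanSpace ℝ (Fin d) → R3) : Prop :=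
  ∃ G, IsWeakGrad Ω u G ∧ ∀ k, MemLp (G k) 2 (volume.restrict Ω)

open Classical in
/-- The weak gradient of `u` on `Ω` (unique up to null sets), with the value `0` if there is
none. -/
noncomputable def weakGrad (Ω : Set (EuclideanSpace ℝ (Fin d)))
    (u : EuclideanSpace ℝ (Fin d) → R3) : Fin d → EuclideanSpace ℝ (Fin d) → R3 :=
  if h : ∃ G, IsWeakGrad Ω u G then h.choose else 0

/-- The Dirichlet energy `E[u] = ∫_Ω ½ |∇u|²`, where `|∇u|² = ∑_k |∂_k u|²`. It is meaningful for
`u` with `HasFiniteDirichletEnergy Ω u`. -/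
noncomputable def dirichletEnergy (Ω : Set (EuclideanSpace ℝ (Fin d)))
    (u : EuclideanSpace ℝ (Fin d) → R3) : ℝ :=
  ∫ x in Ω, (1 / 2 : ℝ) * ∑ k, ‖weakGrad Ω u k x‖ ^ 2

/-- `u ∈ H¹(Ω; ℝ³)`. -/
def MemH1 (Ω : Set (EuclideanSpace ℝ (Fin d))) (u : EuclideanSpace ℝ (Fin d) → R3) : Prop :=
  MemLp u 2 (volume.restrict Ω) ∧ HasFiniteDirichletEnergy Ω u

/-- `u ∈ H¹₀(Ω; ℝ³)`, the closure of `C_c^∞(Ω; ℝ³)` in `H¹(Ω; ℝ³)`. -/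
def MemH10 (Ω : Set (EuclideanSpace ℝ (Fin d))) (u : EuclideanSpace ℝ (Fin d) → R3) : Prop :=
  MemLp u 2 (volume.restrict Ω) ∧
  ∃ G, IsWeakGrad Ω u G ∧ (∀ k, MemLp (G k) 2 (volume.restrict Ω)) ∧
    ∃ φ : ℕ → EuclideanSpace ℝ (Fin d) → R3, (∀ n, IsTestFunction Ω (φ n)) ∧
      Tendsto (fun n => eLpNorm (φ n - u) 2 (volume.restrict Ω)) atTop (𝓝 0) ∧
      ∀ k, Tendsto (fun n => eLpNorm (partialD k (φ n) - G k) 2 (volume.restrict Ω)) atTop (𝓝 0)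

/-- `L = Δu` weakly on `Ω`, i.e. `L` is the weak divergence of the weak gradient of `u`. -/
def IsWeakLaplacian (Ω : Set (EuclideanSpace ℝ (Fin d)))
    (u L : EuclideanSpace ℝ (Fin d) → R3) : Prop :=
  LocallyIntegrableOn L Ω ∧ ∃ G, IsWeakGrad Ω u G ∧
    ∀ φ : EuclideanSpace ℝ (Fin d) → ℝ, IsTestFunction Ω φ →
      ∑ k, ∫ x in Ω, partialD k φ x • G k x = - ∫ x in Ω, φ x • L x

/-- Homogeneous Neumann condition `∂u/∂ν = 0` on `∂Ω` in the weak sense, for `u` with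
`∇u ∈ L²(Ω)` and `Δu = L ∈ L²(Ω)`: the normal trace functional
`v ↦ ∫_Ω ∇u : ∇v + ∫_Ω Δu · v` vanishes on `H¹(Ω; ℝ³)`. -/
def HasZeroNormalDerivative (Ω : Set (EuclideanSpace ℝ (Fin d)))
    (u L : EuclideanSpace ℝ (Fin d) → R3) : Prop :=
  ∃ G, IsWeakGrad Ω u G ∧ (∀ k, MemLp (G k) 2 (volume.restrict Ω)) ∧
    ∀ (v : EuclideanSpace ℝ (Fin d) → R3) (H : Fin d → EuclideanSpace ℝ (Fin d) → R3),
      MemLp v 2 (volume.restrict Ω) → IsWeakGrad Ω v H →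
      (∀ k, MemLp (H k) 2 (volume.restrict Ω)) →
      (∑ k, ∫ x in Ω, inner ℝ (G k x) (H k x)) + ∫ x in Ω, inner ℝ (L x) (v x) = 0

end Sobolev

/-- The two kinds of boundary conditions: time-independent Dirichlet, homogeneous Neumann. -/
inductive BoundaryCondition : Type
  | dirichlet
  | neumann

/-- `P(m) v = α (I - m mᵀ / |m|²) v + β m × v`; for `m = 0` this reads `P(0) v = α v`. -/
noncomputable def opP (α β : ℝ) (m v : R3) : R3 :=
  α • (v - (inner ℝ m v / ‖m‖ ^ 2) • m) + β • WithLp.toLp 2 (crossProduct m.ofLp v.ofLp)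

/-- The tableaux `A`, `D` of an `s`-stage PRK method: both are lower triangular with positive
diagonal, and the rows of `D` sum to one. -/
structure IsPRKTableau {s : ℕ} (A D : Matrix (Fin s) (Fin s) ℝ) : Prop where
  lowerA : ∀ i j, i < j → A i j = 0
  lowerD : ∀ i j, i < j → D i j = 0
  diagA : ∀ i, 0 < A i i
  diagD : ∀ i, 0 < D i i
  rowD : ∀ i, ∑ j, D i j = 1

/-- The shift matrix `J`: row `i` of `J A` is row `i - 1` of `A`, and the first row is zero. -/
def shiftJ (s : ℕ) : Matrix (Fin s) (Fin s) ℝ :=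
  Matrix.of fun i j => if (i : ℕ) = (j : ℕ) + 1 then 1 else 0

/-- `Q = B D A + (B D A)ᵀ - b bᵀ`, `B = diag(b)`. -/
def matQ {s : ℕ} (A D : Matrix (Fin s) (Fin s) ℝ) (b : Fin s → ℝ) : Matrix (Fin s) (Fin s) ℝ :=
  Matrix.diagonal b * D * A + (Matrix.diagonal b * D * A).transpose - Matrix.vecMulVec b b

/-- `R = b bᵀ - B J A - (B J A)ᵀ`, `B = diag(b)`. -/
def matR {s : ℕ} (A : Matrix (Fin s) (Fin s) ℝ) (b : Fin s → ℝ) : Matrix (Fin s) (Fin s) ℝ :=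
  Matrix.vecMulVec b b - Matrix.diagonal b * shiftJ s * A
    - (Matrix.diagonal b * shiftJ s * A).transpose

/-- The field `P(u_{j-1}) ∑_{k ≤ j} d_{jk} Δu_k`. The stage `j ∈ {1, …, s}` is the index
`j : Fin s`, so that `u_j` is `u j.succ` and `u_{j-1}` is `u j.castSucc`; `L k` stands for
`Δu_k`. -/
noncomputable def prkSlope {d s : ℕ} (α β : ℝ) (D : Matrix (Fin s) (Fin s) ℝ)
    (u : Fin (s + 1) → EuclideanSpace ℝ (Fin d) → R3)
    (L : Fin s → EuclideanSpace ℝ (Fin d) → R3) (j : Fin s) (x : EuclideanSpace ℝ (Fin d)) : R3 :=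
  opP α β (u j.castSucc x) (∑ k ∈ Finset.Iic j, D j k • L k x)

/-- One step `m = mⁿ ↦ m' = mⁿ⁺¹` of the PRK projection scheme with time step `τ`, stages
`u 0 = mⁿ, u 1, …, u s`, Laplacians `L` of the stages `u 1, …, u s`, and with the value `mt`
before projection. All stages have the same Dirichlet data as `mⁿ`, respectively all stages
have zero normal derivative. -/
structure IsPRKStep {d s : ℕ} (Ω : Set (EuclideanSpace ℝ (Fin d))) (bc : BoundaryCondition)
    (α β τ : ℝ) (A D : Matrix (Fin s) (Fin s) ℝ) (b : Fin s → ℝ)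
    (m : EuclideanSpace ℝ (Fin d) → R3) (u : Fin (s + 1) → EuclideanSpace ℝ (Fin d) → R3)
    (L : Fin s → EuclideanSpace ℝ (Fin d) → R3)
    (mt m' : EuclideanSpace ℝ (Fin d) → R3) : Prop where
  init : u 0 = m
  memH1 : ∀ i : Fin s, MemH1 Ω (u i.succ - m)
  laplacian : ∀ i : Fin s, IsWeakLaplacian Ω (u i.succ) (L i)
  laplacian_memLp : ∀ i : Fin s, MemLp (L i) 2 (volume.restrict Ω)
  boundary_dirichlet : bc = .dirichlet → ∀ i : Fin s, MemH10 Ω (u i.succ - m)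
  boundary_neumann : bc = .neumann → ∀ i : Fin s, HasZeroNormalDerivative Ω (u i.succ) (L i)
  stage : ∀ i : Fin s, ∀ᵐ x ∂(volume.restrict Ω),
    u i.succ x = u 0 x + τ • ∑ j ∈ Finset.Iic i, A i j • prkSlope α β D u L j x
  predictor : ∀ᵐ x ∂(volume.restrict Ω),
    mt x = u 0 x + τ • ∑ j, b j • prkSlope α β D u L j x
  projection : ∀ᵐ x ∂(volume.restrict Ω), m' x = ‖mt x‖⁻¹ • mt x

/-! The two halves of the scheme's analysis come from one Runge-Kutta identity in a Hilbert space,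
`norm_sq_add_smul_sum_eq`. For an update g₀ + τ ∑ bⱼWⱼ and internal points pⱼ = g₀ + τ ∑ MⱼₗWₗ, the
change of the squared norm is 2τ ∑ bⱼ⟨pⱼ,Wⱼ⟩ minus τ² times the quadratic form of BM + (BM)ᵀ - bbᵀ.

Length: in ℝ³, pointwise, take M = JA. Then pⱼ is the lagged stage at which P is evaluated, P(pⱼ)v
is orthogonal to pⱼ, and the quadratic form is that of -R. Hence |m̃| ≥ |mⁿ| = 1.

Energy: in L², take M = DA and Wⱼ the gradient of the slope. The pairing ∑ₖ dⱼₖ⟨∇uₖ,Wⱼ⟩ is, by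
Green's formula and either boundary condition, -∫ v·P(uⱼ₋₁)v ≤ 0 with v = ∑ₖ dⱼₖΔuₖ, and the form is
that of Q. Hence the energy of m̃ is at most that of mⁿ. The slopes are only known to solve the
stage equations, so their gradients are obtained by inverting A: τ times each slope is a combination
of the increments uᵢ - mⁿ, which lie in H¹ and are admissible in Green's formula.

Projection: x ↦ x/|x| has derivative of norm at most 1 where |x| ≥ 1, so by the chain rule
`IsWeakGrad.comp` normalizing m̃ does not raise the energy. The chain rule for weak gradients is
proved by mollification. -/

/-! ### L¹ convergence of mollifications -/

section Mollification

open Convolution ContinuousLinearMap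

variable {V W : Type*} [NormedAddCommGroup V] [NormedSpace ℝ V] [HasContDiffBump V]
  [MeasurableSpace V] [BorelSpace V] [FiniteDimensional ℝ V]
  [NormedAddCommGroup W] [NormedSpace ℝ W]
  {μ : Measure V} [μ.IsAddHaarMeasure]

/-- Mollifications of an integrable function converge to it in `L¹`. -/
theorem ContDiffBump.tendsto_integral_norm_convolution_sub [CompleteSpace W]
    {φ : ℕ → ContDiffBump (0 : V)} {K : ℝ} {g : V → W}
    (hφ : Tendsto (fun i ↦ (φ i).rOut) atTop (𝓝 0))
    (h'φ : ∀ᶠ i in atTop, (φ i).rOut ≤ K * (φ i).rIn) (hg : Integrable g μ) :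
    Tendsto (fun i ↦ ∫ x, ‖((φ i).normed μ ⋆[lsmul ℝ ℝ, μ] g) x - g x‖ ∂μ) atTop (𝓝 0) := by
  set G : ℕ → V → W := fun i ↦ (φ i).normed μ ⋆[lsmul ℝ ℝ, μ] g with hG
  set S : ℕ → V → ℝ := fun i ↦ (φ i).normed μ ⋆[lsmul ℝ ℝ, μ] (fun x ↦ ‖g x‖) with hS
  have hφi : ∀ i, Integrable ((φ i).normed μ) μ := fun i ↦ (φ i).integrable_normed
  have hGi : ∀ i, Integrable (G i) μ := fun i ↦ (hφi i).integrable_convolution _ hg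
  have hSi : ∀ i, Integrable (S i) μ := fun i ↦ (hφi i).integrable_convolution _ hg.norm
  have hGS : ∀ i x, ‖G i x‖ ≤ S i x := fun i x ↦ by
    refine (norm_integral_le_integral_norm _).trans_eq (integral_congr_ae ?_)
    filter_upwards with t
    simp [norm_smul, abs_of_nonneg ((φ i).nonneg_normed t)]
  have hSint : ∀ i, ∫ x, S i x ∂μ = ∫ x, ‖g x‖ ∂μ := fun i ↦ by
    rw [integral_convolution _ (hφi i) hg.norm, (φ i).integral_normed]
    simp
  have hGae := ae_convolution_tendsto_right_of_locallyIntegrable (μ := μ) hφ h'φ hg.locallyIntegrable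
  have hSae := ae_convolution_tendsto_right_of_locallyIntegrable (μ := μ) hφ h'φ
    hg.norm.locallyIntegrable
  -- A Scheffé-type argument. `G i` has no fixed integrable majorant, but `B i` is dominated by
  -- 4‖g‖, tends to 0 a.e., and satisfies ‖G i - g‖ ≤ B i + (S i - ‖g‖). The last bracket has
  -- integral zero because mollification preserves the integral of ‖g‖.
  set B : ℕ → V → ℝ := fun i x ↦
    min ‖G i x - g x‖ (2 * ‖g x‖) + 2 * max (‖g x‖ - S i x) 0 with hB
  have hS0 : ∀ i x, 0 ≤ S i x := fun i x ↦ (norm_nonneg _).trans (hGS i x)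
  have hBlim : Tendsto (fun i ↦ ∫ x, B i x ∂μ) atTop (𝓝 (∫ _, (0 : ℝ) ∂μ)) := by
    refine tendsto_integral_of_dominated_convergence (fun x ↦ 4 * ‖g x‖) (fun i ↦ ?_)
      (hg.norm.const_mul 4) (fun i ↦ ?_) ?_
    · have h1 := (hGi i).aestronglyMeasurable
      have h2 := (hSi i).aestronglyMeasurable
      have h3 := hg.aestronglyMeasurable
      exact (((h1.sub h3).norm).inf (h3.norm.const_mul 2)).add
        (((h3.norm.sub h2).sup aestronglyMeasurable_const).const_mul 2)
    · filter_upwards with x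
      have h1 : min ‖G i x - g x‖ (2 * ‖g x‖) ≤ 2 * ‖g x‖ := min_le_right _ _
      have h2 : 0 ≤ min ‖G i x - g x‖ (2 * ‖g x‖) := by positivity
      have h3 : max (‖g x‖ - S i x) 0 ≤ ‖g x‖ :=
        max_le (by linarith [hS0 i x]) (norm_nonneg _)
      have h4 : 0 ≤ max (‖g x‖ - S i x) 0 := le_max_right _ _
      rw [Real.norm_of_nonneg (by simp only [hB]; linarith)]
      simp only [hB]
      linarith
    · filter_upwards [hGae, hSae] with x h1 h2
      have h3 : Tendsto (fun i ↦ ‖G i x - g x‖) atTop (𝓝 0) := by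
        simpa using (h1.sub_const (g x)).norm
      have h4 : Tendsto (fun i ↦ ‖g x‖ - S i x) atTop (𝓝 0) := by
        simpa using h2.const_sub ‖g x‖
      have h5 := (h3.min (tendsto_const_nhds (x := 2 * ‖g x‖))).add
        ((h4.max (tendsto_const_nhds (x := (0 : ℝ)))).const_mul 2)
      simpa using h5
  rw [integral_zero] at hBlim
  refine squeeze_zero (fun i ↦ integral_nonneg fun x ↦ norm_nonneg _) (fun i ↦ ?_) hBlim
  have hBi : Integrable (B i) μ :=
    (((hGi i).sub hg).norm.inf (hg.norm.const_mul 2)).add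
        (((hg.norm.sub (hSi i)).sup (integrable_zero _ _ _)).const_mul 2)
  have hDi : Integrable (fun x ↦ S i x - ‖g x‖) μ := (hSi i).sub hg.norm
  have hzero : ∫ x, (S i x - ‖g x‖) ∂μ = 0 := by
    rw [integral_sub (hSi i) hg.norm, hSint, sub_self]
  have : ∫ x, B i x ∂μ = ∫ x, (B i x + (S i x - ‖g x‖)) ∂μ := by
    rw [integral_add hBi hDi, hzero, add_zero]
  rw [this]
  refine integral_mono ((hGi i).sub hg).norm (hBi.add hDi) fun x ↦ ?_
  have h1 : ‖G i x - g x‖ ≤ ‖G i x‖ + ‖g x‖ := norm_sub_le _ _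
  have h2 := hGS i x
  simp only [hB]
  rcases min_cases ‖G i x - g x‖ (2 * ‖g x‖) with h | h <;>
  rcases max_cases (‖g x‖ - S i x) 0 with h' | h' <;> linarith

end Mollification

theorem tendsto_integral_of_tendsto_integral_norm_sub {α W : Type*} [MeasurableSpace α]
    [NormedAddCommGroup W] [NormedSpace ℝ W] {μ : Measure α} {f : ℕ → α → W} {g : α → W}
    (hf : ∀ᶠ n in atTop, Integrable (f n) μ) (hg : Integrable g μ)
    (h : Tendsto (fun n ↦ ∫ x, ‖f n x - g x‖ ∂μ) atTop (𝓝 0)) :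
    Tendsto (fun n ↦ ∫ x, f n x ∂μ) atTop (𝓝 (∫ x, g x ∂μ)) := by
  rw [tendsto_iff_norm_sub_tendsto_zero]
  refine squeeze_zero' (Eventually.of_forall fun n ↦ norm_nonneg _) ?_ h
  filter_upwards [hf] with n hn
  rw [← integral_sub hn hg]
  exact norm_integral_le_integral_norm _

/-! ### Mollification and weak derivatives -/

section ChainRule

open Convolution ContinuousLinearMap

variable {d : ℕ} {Ω : Set (EuclideanSpace ℝ (Fin d))} {u : EuclideanSpace ℝ (Fin d) → R3}
  {G : Fin d → EuclideanSpace ℝ (Fin d) → R3}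

theorem partialD_eq_zero_of_notMem_tsupport {F : Type*} [NormedAddCommGroup F] [NormedSpace ℝ F]
    {φ : EuclideanSpace ℝ (Fin d) → F} {x : EuclideanSpace ℝ (Fin d)} (hx : x ∉ tsupport φ)
    (k : Fin d) : partialD k φ x = 0 := by
  have : fderiv ℝ φ x = 0 :=
    Function.notMem_support.1 fun h ↦ hx (support_fderiv_subset ℝ h)
  simp [partialD, this]

/-- A test function sees a field only on a compact set. Cutting the locally integrable field off
there gives an integrable field on the whole space, which can be convolved. -/
theorem setIntegral_smul_eq_integral_smul_indicator {V W : Type*} [MeasurableSpace V]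
    [NormedAddCommGroup W] [NormedSpace ℝ W] {μ : Measure V} {K U : Set V} (hKU : K ⊆ U)
    {f : V → ℝ} (hf : ∀ x ∉ K, f x = 0) (g : V → W) :
    ∫ x in U, f x • g x ∂μ = ∫ x, f x • K.indicator g x ∂μ := by
  rw [setIntegral_eq_integral_of_forall_compl_eq_zero]
  · refine integral_congr_ae (Eventually.of_forall fun x ↦ ?_)
    by_cases hx : x ∈ K
    · simp [hx]
    · simp [hf x hx]
  · intro x hx
    simp [hf x fun h ↦ hx (hKU h)]

theorem MeasureTheory.LocallyIntegrableOn.integrable_indicator_of_isCompact {V W : Type*} [TopologicalSpace V]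
    [T2Space V] [MeasurableSpace V] [OpensMeasurableSpace V] [NormedAddCommGroup W]
    {μ : Measure V} {K U : Set V} {f : V → W}
    (hf : LocallyIntegrableOn f U μ) (hK : IsCompact K) (hKU : K ⊆ U) :
    Integrable (K.indicator f) μ :=
  (integrable_indicator_iff hK.measurableSet).2 (hf.integrableOn_compact_subset hKU hK)

/-- Mollification commutes with weak differentiation away from the boundary. -/
theorem IsWeakGrad.partialD_convolution (h : IsWeakGrad Ω u G)
    {K : Set (EuclideanSpace ℝ (Fin d))} (hK : IsCompact K) (hKΩ : K ⊆ Ω)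
    (ρ : ContDiffBump (0 : EuclideanSpace ℝ (Fin d))) {x : EuclideanSpace ℝ (Fin d)}
    (hx : Metric.closedBall x ρ.rOut ⊆ K) (k : Fin d) :
    partialD k (ρ.normed volume ⋆[lsmul ℝ ℝ, volume] K.indicator u) x =
      (ρ.normed volume ⋆[lsmul ℝ ℝ, volume] K.indicator (G k)) x := by
  have hu := h.locInt.integrable_indicator_of_isCompact hK hKΩ
  have hρ : ContDiff ℝ (⊤ : ℕ∞) (ρ.normed volume) := ρ.contDiff_normed
  have hρc : HasCompactSupport (ρ.normed volume) := ρ.hasCompactSupport_normed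
  have hd := hρc.hasFDerivAt_convolution_left (lsmul ℝ ℝ) (hρ.of_le (by norm_cast))
    hu.locallyIntegrable x
  -- The reflected, translated bump is supported in the ball around x, hence in Ω, so the weak
  -- gradient may be tested with it; both convolutions at x are integrals against ψ and its
  -- derivative.
  set ψ : EuclideanSpace ℝ (Fin d) → ℝ := fun t ↦ ρ.normed volume (x - t) with hψ
  have hψd : ∀ t, partialD k ψ t = -fderiv ℝ (ρ.normed volume) (x - t) (EuclideanSpace.single k 1) := by
    intro t
    have h1 : HasFDerivAt ψ ((fderiv ℝ (ρ.normed volume) (x - t)).comp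
        (-ContinuousLinearMap.id ℝ (EuclideanSpace ℝ (Fin d)))) t :=
      ((hρ.differentiable (by simp)) (x - t)).hasFDerivAt.comp t ((hasFDerivAt_id t).const_sub x)
    simp [partialD, h1.fderiv]
  have hψs : tsupport ψ ⊆ Metric.closedBall x ρ.rOut := by
    refine closure_minimal (fun t ht ↦ ?_) Metric.isClosed_closedBall
    have : x - t ∈ Function.support (ρ.normed volume) := ht
    rw [ρ.support_normed_eq, mem_ball_zero_iff] at this
    rw [Metric.mem_closedBall', dist_eq_norm]
    exact this.le
  have hψt : IsTestFunction Ω ψ :=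
    ⟨hρ.comp (contDiff_const.sub contDiff_id),
      HasCompactSupport.of_support_subset_isCompact (isCompact_closedBall x ρ.rOut)
        (subset_closure.trans hψs), (hψs.trans hx).trans hKΩ⟩
  have hψK : ∀ t ∉ K, ψ t = 0 := fun t ht ↦
    image_eq_zero_of_notMem_tsupport fun h' ↦ ht (hx (hψs h'))
  have hψK' : ∀ t ∉ K, partialD k ψ t = 0 := fun t ht ↦
    partialD_eq_zero_of_notMem_tsupport (fun h' ↦ ht (hx (hψs h'))) k
  have hparts := h.parts k ψ hψt
  rw [setIntegral_smul_eq_integral_smul_indicator hKΩ hψK,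
    setIntegral_smul_eq_integral_smul_indicator hKΩ hψK'] at hparts
  have hfd : HasCompactSupport (fderiv ℝ (ρ.normed volume)) := hρc.fderiv ℝ
  have hex := hfd.convolutionExists_left ((lsmul ℝ ℝ).precompL (EuclideanSpace ℝ (Fin d)))
    (hρ.continuous_fderiv (by simp)) hu.locallyIntegrable x
  rw [partialD, hd.fderiv, convolution_eq_swap, convolution_lsmul_swap,
    ContinuousLinearMap.integral_apply hex.integrable_swap]
  simp only [hψd, neg_smul, integral_neg, neg_inj] at hparts
  rw [← hparts]
  rfl

end ChainRule

/-! ### Chain rule for weak gradients -/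

section ChainRule

open Convolution ContinuousLinearMap

variable {d : ℕ} {Ω : Set (EuclideanSpace ℝ (Fin d))} {u : EuclideanSpace ℝ (Fin d) → R3}
  {G : Fin d → EuclideanSpace ℝ (Fin d) → R3}

theorem aestronglyMeasurable_fderiv_apply {α : Type*} [MeasurableSpace α] {μ : Measure α}
    {F : R3 → R3} (hF : ContDiff ℝ 1 F) {v g : α → R3} (hv : AEStronglyMeasurable v μ)
    (hg : AEStronglyMeasurable g μ) :
    AEStronglyMeasurable (fun x ↦ fderiv ℝ F (v x) (g x)) μ := by
  have hc : Continuous fun p : R3 × R3 ↦ fderiv ℝ F p.1 p.2 :=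
    ((hF.continuous_fderiv one_ne_zero).comp continuous_fst).clm_apply continuous_snd
  exact hc.comp_aestronglyMeasurable (hv.prodMk hg)

theorem norm_sub_le_of_norm_fderiv_le {F : R3 → R3} (hF : ContDiff ℝ 1 F) {C : ℝ}
    (hC : ∀ y, ‖fderiv ℝ F y‖ ≤ C) (y z : R3) : ‖F y - F z‖ ≤ C * ‖y - z‖ :=
  convex_univ.norm_image_sub_le_of_norm_fderiv_le
    (fun x _ ↦ (hF.differentiable one_ne_zero) x) (fun x _ ↦ hC x) (Set.mem_univ z)
    (Set.mem_univ y)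

theorem MeasureTheory.LocallyIntegrableOn.mono_restrict {V W W' : Type*} [TopologicalSpace V]
    [MeasurableSpace V] [NormedAddCommGroup W] [NormedAddCommGroup W'] {μ : Measure V} {U : Set V}
    {f : V → W} {g : V → W'} (hf : LocallyIntegrableOn f U μ)
    (hg : AEStronglyMeasurable g (μ.restrict U)) (h : ∀ x, ‖g x‖ ≤ ‖f x‖) :
    LocallyIntegrableOn g U μ := by
  intro x hx
  obtain ⟨s, hs, hfs⟩ := hf x hx
  exact ⟨s ∩ U, inter_mem hs self_mem_nhdsWithin, Integrable.mono (hfs.mono_set Set.inter_subset_left)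
    (hg.mono_set Set.inter_subset_right) (Eventually.of_forall h)⟩

/-- Chain rule for the weak gradient. -/
theorem IsWeakGrad.comp (hΩ : IsOpen Ω) {F : R3 → R3} (hF : ContDiff ℝ 1 F) {C : ℝ}
    (hC : ∀ y, ‖fderiv ℝ F y‖ ≤ C) (h : IsWeakGrad Ω u G) :
    IsWeakGrad Ω (fun x ↦ F (u x)) (fun k x ↦ fderiv ℝ F (u x) (G k x)) := by
  have hC0 : 0 ≤ C := (norm_nonneg _).trans (hC 0)
  have hum := h.locInt.aestronglyMeasurable
  refine ⟨?_, fun k ↦ ?_, fun k ψ hψ ↦ ?_⟩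
  · have hdom : LocallyIntegrableOn (fun x ↦ C * ‖u x‖ + ‖F 0‖) Ω := by
      have h1 : LocallyIntegrableOn (fun x ↦ C * ‖u x‖) Ω := by
        simpa [Pi.smul_def] using h.locInt.norm.smul C
      exact h1.add (locallyIntegrableOn_const _)
    refine hdom.mono_restrict (hF.continuous.comp_aestronglyMeasurable hum) fun x ↦ ?_
    rw [Real.norm_of_nonneg (by positivity)]
    have h1 := norm_sub_le_of_norm_fderiv_le hF hC (u x) 0
    have h2 : ‖F (u x)‖ ≤ ‖F (u x) - F 0‖ + ‖F 0‖ := by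
      simpa using norm_add_le (F (u x) - F 0) (F 0)
    rw [sub_zero] at h1
    linarith
  · have hdom : LocallyIntegrableOn (fun x ↦ C * ‖G k x‖) Ω := by
      simpa [Pi.smul_def] using (h.locInt_grad k).norm.smul C
    refine hdom.mono_restrict (aestronglyMeasurable_fderiv_apply hF hum
      (h.locInt_grad k).aestronglyMeasurable) fun x ↦ ?_
    rw [Real.norm_of_nonneg (by positivity)]
    exact (le_opNorm _ _).trans (by gcongr; exact hC _)
  · have hψc : IsCompact (tsupport ψ) := hψ.compact
    -- The margin δ leaves room to mollify: for radii up to δ, balls centred in the support of ψ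
    -- stay in K.
    obtain ⟨δ, hδ, hδΩ⟩ := hψc.exists_cthickening_subset_open hΩ hψ.supp
    set K := Metric.cthickening δ (tsupport ψ) with hKdef
    have hK : IsCompact K := hψc.cthickening
    have hψK : tsupport ψ ⊆ K := Metric.self_subset_cthickening _
    set v := K.indicator u with hv
    set g := K.indicator (G k) with hg
    have hvi : Integrable v := h.locInt.integrable_indicator_of_isCompact hK hδΩ
    have hgi : Integrable g := (h.locInt_grad k).integrable_indicator_of_isCompact hK hδΩ
    set r : ℕ → ℝ := fun n ↦ 1 / ((n : ℝ) + 1) with hr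
    have hrpos : ∀ n, 0 < r n := fun n ↦ by positivity
    have hrlim : Tendsto r atTop (𝓝 0) := tendsto_one_div_add_atTop_nhds_zero_nat
    -- Inner and outer radii stay comparable, as a.e. convergence by Lebesgue differentiation
    -- requires.
    let ρ : ℕ → ContDiffBump (0 : EuclideanSpace ℝ (Fin d)) := fun n ↦
      ⟨r n / 2, r n, by linarith [hrpos n], by linarith [hrpos n]⟩
    have hρr : Tendsto (fun n ↦ (ρ n).rOut) atTop (𝓝 0) := hrlim
    have hρK : ∀ᶠ n in atTop, (ρ n).rOut ≤ 2 * (ρ n).rIn :=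
      Eventually.of_forall fun n ↦ by change r n ≤ 2 * (r n / 2); linarith
    set V : ℕ → EuclideanSpace ℝ (Fin d) → R3 := fun n ↦
      (ρ n).normed volume ⋆[lsmul ℝ ℝ, volume] v with hV
    set H : ℕ → EuclideanSpace ℝ (Fin d) → R3 := fun n ↦
      (ρ n).normed volume ⋆[lsmul ℝ ℝ, volume] g with hH
    have hVi : ∀ n, Integrable (V n) := fun n ↦ (ρ n).integrable_normed.integrable_convolution _ hvi
    have hHi : ∀ n, Integrable (H n) := fun n ↦ (ρ n).integrable_normed.integrable_convolution _ hgi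
    have hV1 : Tendsto (fun n ↦ ∫ x, ‖V n x - v x‖) atTop (𝓝 0) :=
      ContDiffBump.tendsto_integral_norm_convolution_sub hρr hρK hvi
    have hH1 : Tendsto (fun n ↦ ∫ x, ‖H n x - g x‖) atTop (𝓝 0) :=
      ContDiffBump.tendsto_integral_norm_convolution_sub hρr hρK hgi
    have hVae : ∀ᵐ x, Tendsto (fun n ↦ V n x) atTop (𝓝 (v x)) :=
      ContDiffBump.ae_convolution_tendsto_right_of_locallyIntegrable hρr hρK hvi.locallyIntegrable
    have hVd : ∀ n, ContDiff ℝ 1 (V n) := fun n ↦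
      (ρ n).hasCompactSupport_normed.contDiff_convolution_left (n := 1) _ (ρ n).contDiff_normed
        hvi.locallyIntegrable
    have hψ1 : ContDiff ℝ 1 ψ := hψ.smooth.of_le (by norm_cast)
    have hdψ : Continuous (partialD k ψ) :=
      (hψ1.continuous_fderiv one_ne_zero).clm_apply continuous_const
    have hdψc : HasCompactSupport (partialD k ψ) := hψ.compact.fderiv_apply ℝ _
    obtain ⟨M, hM⟩ := hψ.compact.exists_bound_of_continuous hψ.smooth.continuous
    obtain ⟨N, hN⟩ := hdψc.exists_bound_of_continuous hdψ
    have hM0 : 0 ≤ M := (norm_nonneg _).trans (hM 0)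
    have hN0 : 0 ≤ N := (norm_nonneg _).trans (hN 0)
    have hbound : ∀ y w : R3, ‖fderiv ℝ F y w‖ ≤ C * ‖w‖ := fun y w ↦
      (le_opNorm _ _).trans (by gcongr; exact hC _)
    have hLi : ∀ n, Integrable (fun x ↦ partialD k ψ x • F (V n x)) := fun n ↦
      (hdψ.smul (hF.continuous.comp (hVd n).continuous)).integrable_of_hasCompactSupport
        hdψc.smul_right
    have hLdiff : ∀ n x, ‖partialD k ψ x • F (V n x) - partialD k ψ x • F (v x)‖ ≤
        N * C * ‖V n x - v x‖ := fun n x ↦ by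
      rw [← smul_sub, norm_smul, mul_assoc]
      exact mul_le_mul (hN x) (norm_sub_le_of_norm_fderiv_le hF hC _ _) (norm_nonneg _) hN0
    have hLdi : ∀ n, Integrable
        (fun x ↦ partialD k ψ x • F (V n x) - partialD k ψ x • F (v x)) := fun n ↦ by
      refine (((hVi n).sub hvi).norm.const_mul (N * C)).mono' ?_
        (Eventually.of_forall (hLdiff n))
      exact (hLi n).aestronglyMeasurable.sub (hdψ.aestronglyMeasurable.smul
        (hF.continuous.comp_aestronglyMeasurable hvi.aestronglyMeasurable))
    have hL0i : Integrable (fun x ↦ partialD k ψ x • F (v x)) := by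
      refine ((hLi 0).sub (hLdi 0)).congr (Eventually.of_forall fun x ↦ ?_)
      simp
    have hLlim : Tendsto (fun n ↦ ∫ x, partialD k ψ x • F (V n x)) atTop
        (𝓝 (∫ x, partialD k ψ x • F (v x))) := by
      refine tendsto_integral_of_tendsto_integral_norm_sub (Eventually.of_forall hLi) hL0i ?_
      refine squeeze_zero (fun n ↦ integral_nonneg fun x ↦ norm_nonneg _) (fun n ↦ ?_)
        (by simpa using hV1.const_mul (N * C))
      rw [← integral_const_mul]
      exact integral_mono (hLdi n).norm (((hVi n).sub hvi).norm.const_mul _) (hLdiff n)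
    have hRi : ∀ (w z : EuclideanSpace ℝ (Fin d) → R3), AEStronglyMeasurable w → Integrable z →
        Integrable (fun x ↦ ψ x • fderiv ℝ F (w x) (z x)) := fun w z hw hz ↦ by
      refine (hz.norm.const_mul (M * C)).mono' (hψ.smooth.continuous.aestronglyMeasurable.smul
        (aestronglyMeasurable_fderiv_apply hF hw hz.aestronglyMeasurable))
        (Eventually.of_forall fun x ↦ ?_)
      rw [norm_smul, mul_assoc]
      exact mul_le_mul (hM x) (hbound _ _) (norm_nonneg _) hM0
    -- The right-hand side is split as H n = g + (H n - g): the part with g converges by dominated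
    -- convergence and continuity of the derivative of F, the remainder by the bound C and L¹
    -- convergence.
    have hRlim1 : Tendsto (fun n ↦ ∫ x, ψ x • fderiv ℝ F (V n x) (g x)) atTop
        (𝓝 (∫ x, ψ x • fderiv ℝ F (v x) (g x))) := by
      refine tendsto_integral_of_dominated_convergence (fun x ↦ M * C * ‖g x‖)
        (fun n ↦ (hRi _ _ (hVi n).aestronglyMeasurable hgi).aestronglyMeasurable)
        (hgi.norm.const_mul _) (fun n ↦ Eventually.of_forall fun x ↦ ?_) ?_
      · rw [norm_smul, mul_assoc]
        exact mul_le_mul (hM x) (hbound _ _) (norm_nonneg _) hM0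
      · filter_upwards [hVae] with x hx
        have hc : Continuous fun y ↦ fderiv ℝ F y (g x) :=
          (hF.continuous_fderiv one_ne_zero).clm_apply continuous_const
        exact ((hc.tendsto _).comp hx).const_smul _
    have hRlim2 : Tendsto (fun n ↦ ∫ x, ψ x • fderiv ℝ F (V n x) (H n x - g x)) atTop (𝓝 0) := by
      refine squeeze_zero_norm (fun n ↦ ?_) (by simpa using hH1.const_mul (M * C))
      rw [← integral_const_mul]
      refine (norm_integral_le_integral_norm _).trans (integral_mono
        (hRi _ _ (hVi n).aestronglyMeasurable ((hHi n).sub hgi)).norm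
        (((hHi n).sub hgi).norm.const_mul _) fun x ↦ ?_)
      dsimp only
      rw [norm_smul, mul_assoc]
      exact mul_le_mul (hM x) (hbound _ _) (norm_nonneg _) hM0
    have hRlim : Tendsto (fun n ↦ ∫ x, ψ x • fderiv ℝ F (V n x) (H n x)) atTop
        (𝓝 (∫ x, ψ x • fderiv ℝ F (v x) (g x))) := by
      have := hRlim1.add hRlim2
      rw [add_zero] at this
      refine this.congr fun n ↦ ?_
      refine (integral_add (hRi _ _ (hVi n).aestronglyMeasurable hgi)
        (hRi _ _ (hVi n).aestronglyMeasurable ((hHi n).sub hgi))).symm.trans ?_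
      simp [← smul_add]
    have heq : ∀ᶠ n in atTop, ∫ x, partialD k ψ x • F (V n x) =
        -∫ x, ψ x • fderiv ℝ F (V n x) (H n x) := by
      filter_upwards [hrlim.eventually (Iic_mem_nhds hδ)] with n hn
      have hFV : ContDiff ℝ 1 (fun x ↦ F (V n x)) := hF.comp (hVd n)
      have hibp := integral_smul_fderiv_eq_neg_fderiv_smul_of_integrable (μ := volume)
        (f := ψ) (g := fun x ↦ F (V n x)) (v := EuclideanSpace.single k (1 : ℝ)) (hLi n)
        ((hψ.smooth.continuous.smul ((hFV.continuous_fderiv one_ne_zero).clm_apply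
          continuous_const)).integrable_of_hasCompactSupport hψ.compact.smul_right)
        ((hψ.smooth.continuous.smul hFV.continuous).integrable_of_hasCompactSupport
          hψ.compact.smul_right)
        (fun x _ ↦ hψ1.differentiable one_ne_zero x)
        (fun x _ ↦ hFV.differentiable one_ne_zero x)
      rw [eq_comm, neg_eq_iff_eq_neg]
      refine Eq.trans (integral_congr_ae (Eventually.of_forall fun x ↦ ?_)) hibp
      dsimp only
      by_cases hx : x ∈ tsupport ψ
      · have hball : Metric.closedBall x (ρ n).rOut ⊆ K :=
          (Metric.closedBall_subset_cthickening hx _).trans (Metric.cthickening_mono hn _)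
        have := h.partialD_convolution hK hδΩ (ρ n) hball k
        rw [fderiv_fun_comp x (hF.differentiable one_ne_zero _) ((hVd n).differentiable one_ne_zero x)]
        simp only [ContinuousLinearMap.comp_apply]
        rw [show fderiv ℝ (V n) x (EuclideanSpace.single k 1) = H n x from this]
      · simp [image_eq_zero_of_notMem_tsupport hx]
    have hfinal := tendsto_nhds_unique (hLlim.congr' heq) hRlim.neg
    have hz : ∀ x ∉ tsupport ψ, ψ x = 0 := fun x hx ↦ image_eq_zero_of_notMem_tsupport hx
    rw [setIntegral_smul_eq_integral_smul_indicator hψ.supp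
        fun x hx ↦ partialD_eq_zero_of_notMem_tsupport hx k,
      setIntegral_smul_eq_integral_smul_indicator hψ.supp hz]
    refine Eq.trans (integral_congr_ae (Eventually.of_forall fun x ↦ ?_)) (hfinal.trans
      (congrArg _ (integral_congr_ae (Eventually.of_forall fun x ↦ ?_))))
    · by_cases hx : x ∈ tsupport ψ
      · simp [hv, hx, hψK hx]
      · simp [partialD_eq_zero_of_notMem_tsupport hx k]
    · by_cases hx : x ∈ tsupport ψ
      · simp [hv, hg, hx, hψK hx]
      · simp [hz x hx]

end ChainRule

/-! ### Weak gradients in L² and Green's formulas -/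

section WeakGradient

variable {d : ℕ} {Ω : Set (EuclideanSpace ℝ (Fin d))} {u v L : EuclideanSpace ℝ (Fin d) → R3}
  {G H : Fin d → EuclideanSpace ℝ (Fin d) → R3}

theorem integrableOn_smul_of_tsupport_subset {φ : EuclideanSpace ℝ (Fin d) → ℝ}
    {K : Set (EuclideanSpace ℝ (Fin d))} (hφ : Continuous φ) (hK : IsCompact K) (hKΩ : K ⊆ Ω)
    (hφK : ∀ x ∉ K, φ x = 0) (hu : LocallyIntegrableOn u Ω) :
    IntegrableOn (fun x ↦ φ x • u x) Ω := by
  have h1 : IntegrableOn (fun x ↦ φ x • u x) K :=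
    (hu.integrableOn_compact_subset hKΩ hK).continuousOn_smul hφ.continuousOn hK
  refine (integrableOn_iff_integrable_of_support_subset (s := K) fun x hx ↦ ?_).1 h1 |>.integrableOn
  by_contra h
  exact hx (by simp [hφK x h])

theorem IsTestFunction.continuous_partialD {F : Type*} [NormedAddCommGroup F] [NormedSpace ℝ F]
    {φ : EuclideanSpace ℝ (Fin d) → F} (hφ : IsTestFunction Ω φ) (k : Fin d) :
    Continuous (partialD k φ) :=
  (hφ.smooth.continuous_fderiv (by simp)).clm_apply continuous_const

theorem IsTestFunction.integrableOn_smul {φ : EuclideanSpace ℝ (Fin d) → ℝ}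
    (hφ : IsTestFunction Ω φ) (hu : LocallyIntegrableOn u Ω) :
    IntegrableOn (fun x ↦ φ x • u x) Ω :=
  integrableOn_smul_of_tsupport_subset hφ.smooth.continuous hφ.compact hφ.supp
    (fun _ hx ↦ image_eq_zero_of_notMem_tsupport hx) hu

theorem IsTestFunction.integrableOn_partialD_smul {φ : EuclideanSpace ℝ (Fin d) → ℝ}
    (hφ : IsTestFunction Ω φ) (hu : LocallyIntegrableOn u Ω) (k : Fin d) :
    IntegrableOn (fun x ↦ partialD k φ x • u x) Ω :=
  integrableOn_smul_of_tsupport_subset (hφ.continuous_partialD k) hφ.compact hφ.supp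
    (fun _ hx ↦ partialD_eq_zero_of_notMem_tsupport hx k) hu

theorem IsWeakGrad.add (hu : IsWeakGrad Ω u G) (hv : IsWeakGrad Ω v H) :
    IsWeakGrad Ω (u + v) (G + H) where
  locInt := hu.locInt.add hv.locInt
  locInt_grad k := (hu.locInt_grad k).add (hv.locInt_grad k)
  parts k φ hφ := by
    simp only [Pi.add_apply, smul_add]
    rw [integral_add (hφ.integrableOn_partialD_smul hu.locInt k)
        (hφ.integrableOn_partialD_smul hv.locInt k),
      integral_add (hφ.integrableOn_smul (hu.locInt_grad k))
        (hφ.integrableOn_smul (hv.locInt_grad k)), hu.parts k φ hφ, hv.parts k φ hφ, neg_add]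

theorem IsWeakGrad.const_smul (hu : IsWeakGrad Ω u G) (c : ℝ) : IsWeakGrad Ω (c • u) (c • G) where
  locInt := hu.locInt.smul c
  locInt_grad k := (hu.locInt_grad k).smul c
  parts k φ hφ := by
    simp only [Pi.smul_apply, smul_comm _ c]
    rw [integral_smul, integral_smul, hu.parts k φ hφ, smul_neg]

theorem IsWeakGrad.sum {ι : Type*} (s : Finset ι) {u : ι → EuclideanSpace ℝ (Fin d) → R3}
    {G : ι → Fin d → EuclideanSpace ℝ (Fin d) → R3} (h : ∀ i, IsWeakGrad Ω (u i) (G i)) :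
    IsWeakGrad Ω (∑ i ∈ s, u i) (∑ i ∈ s, G i) := by
  classical
  induction s using Finset.induction_on with
  | empty =>
    refine ⟨?_, fun k ↦ ?_, fun k φ _ ↦ ?_⟩
    · exact locallyIntegrableOn_const (0 : R3)
    · exact locallyIntegrableOn_const (0 : R3)
    · simp
  | insert i s hi ih =>
    rw [Finset.sum_insert hi, Finset.sum_insert hi]
    exact (h i).add ih

theorem IsWeakGrad.congr (h : IsWeakGrad Ω u G) (huv : u =ᵐ[volume.restrict Ω] v) :
    IsWeakGrad Ω v G where
  locInt := h.locInt.congr huv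
  locInt_grad := h.locInt_grad
  parts k φ hφ := by
    rw [← h.parts k φ hφ]
    refine integral_congr_ae ?_
    filter_upwards [huv] with x hx
    rw [hx]

/-- By the fundamental lemma of the calculus of variations. The energy, defined through a chosen
weak gradient, can thus be computed from any other. -/
theorem IsWeakGrad.ae_eq (hΩ : IsOpen Ω) (hG : IsWeakGrad Ω u G) (hH : IsWeakGrad Ω u H)
    (k : Fin d) : G k =ᵐ[volume.restrict Ω] H k := by
  have h := hΩ.ae_eq_zero_of_integral_contDiff_smul_eq_zero (μ := volume)
    ((hG.locInt_grad k).sub (hH.locInt_grad k)) fun φ h1 h2 h3 ↦ by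
      have hφ : IsTestFunction Ω φ := ⟨h1, h2, h3⟩
      have h4 : ∫ x in Ω, φ x • (G k - H k) x = 0 := by
        simp only [Pi.sub_apply, smul_sub]
        rw [integral_sub (hφ.integrableOn_smul (hG.locInt_grad k))
          (hφ.integrableOn_smul (hH.locInt_grad k)), sub_eq_zero, ← neg_inj,
          ← hG.parts k φ hφ, ← hH.parts k φ hφ]
      rw [← h4, setIntegral_eq_integral_of_forall_compl_eq_zero]
      intro x hx
      rw [image_eq_zero_of_notMem_tsupport fun h ↦ hx (h3 h), zero_smul]
  filter_upwards [(ae_restrict_iff' hΩ.measurableSet).2 h] with x hx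
  exact sub_eq_zero.1 hx

theorem weakGrad_spec (h : IsWeakGrad Ω u G) : IsWeakGrad Ω u (weakGrad Ω u) := by
  have hex : ∃ G, IsWeakGrad Ω u G := ⟨G, h⟩
  rw [weakGrad, dif_pos hex]
  exact hex.choose_spec

theorem dirichletEnergy_eq (hΩ : IsOpen Ω) (h : IsWeakGrad Ω u G) :
    dirichletEnergy Ω u = ∫ x in Ω, (1 / 2 : ℝ) * ∑ k, ‖G k x‖ ^ 2 := by
  refine integral_congr_ae ?_
  filter_upwards [ae_all_iff.2 fun k ↦ (weakGrad_spec h).ae_eq hΩ h k] with x hx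
  simp only [hx]

/-- The gradient as an element of the Hilbert space `L²(Ω)^{d × 3}`. -/
noncomputable def gradToLp {Ω : Set (EuclideanSpace ℝ (Fin d))}
    {G : Fin d → EuclideanSpace ℝ (Fin d) → R3}
    (hG : ∀ k, MemLp (G k) 2 (volume.restrict Ω)) :
    PiLp 2 fun _ : Fin d ↦ Lp R3 2 (volume.restrict Ω) :=
  WithLp.toLp 2 fun k ↦ (hG k).toLp (G k)

theorem inner_toLp_toLp {α : Type*} [MeasurableSpace α] {μ : Measure α} {f g : α → R3}
    (hf : MemLp f 2 μ) (hg : MemLp g 2 μ) :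
    inner ℝ (hf.toLp f) (hg.toLp g) = ∫ x, inner ℝ (f x) (g x) ∂μ := by
  rw [L2.inner_def]
  refine integral_congr_ae ?_
  filter_upwards [hf.coeFn_toLp, hg.coeFn_toLp] with x h1 h2
  rw [h1, h2]

theorem inner_gradToLp (hG : ∀ k, MemLp (G k) 2 (volume.restrict Ω))
    (hH : ∀ k, MemLp (H k) 2 (volume.restrict Ω)) :
    inner ℝ (gradToLp hG) (gradToLp hH) = ∑ k, ∫ x in Ω, inner ℝ (G k x) (H k x) := by
  simp only [PiLp.inner_apply, gradToLp, inner_toLp_toLp]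

theorem dirichletEnergy_eq_norm_sq (hΩ : IsOpen Ω) (h : IsWeakGrad Ω u G)
    (hG : ∀ k, MemLp (G k) 2 (volume.restrict Ω)) :
    dirichletEnergy Ω u = 1 / 2 * ‖gradToLp hG‖ ^ 2 := by
  rw [dirichletEnergy_eq hΩ h, ← real_inner_self_eq_norm_sq, inner_gradToLp, integral_const_mul,
    integral_finsetSum]
  · simp only [real_inner_self_eq_norm_sq]
  · exact fun k _ ↦ (hG k).integrable_norm_pow (by norm_num)

/-- Green's formula against vector-valued test functions. -/
theorem IsWeakLaplacian.parts_testFunction (hΩ : IsOpen Ω) (hL : IsWeakLaplacian Ω u L)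
    (hG : IsWeakGrad Ω u G) {φ : EuclideanSpace ℝ (Fin d) → R3} (hφ : IsTestFunction Ω φ) :
    (∑ k, ∫ x in Ω, inner ℝ (G k x) (partialD k φ x)) + ∫ x in Ω, inner ℝ (L x) (φ x) = 0 := by
  obtain ⟨hLi, G', hG', hparts⟩ := hL
  -- The weak Laplacian is tested with scalar functions only, so the formula is assembled coordinate
  -- by coordinate.
  have hφc : ∀ c : Fin 3, IsTestFunction Ω fun x ↦ φ x c := fun c ↦
    ⟨(EuclideanSpace.proj (𝕜 := ℝ) c).contDiff.comp hφ.smooth,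
      hφ.compact.comp_left (g := fun y : R3 ↦ y c) rfl,
      (tsupport_comp_subset (g := fun y : R3 ↦ y c) rfl φ).trans hφ.supp⟩
  have hdc : ∀ (c : Fin 3) (k : Fin d) x, partialD k (fun x ↦ φ x c) x = partialD k φ x c :=
    fun c k x ↦ by
      have h1 := (EuclideanSpace.proj (𝕜 := ℝ) c).hasFDerivAt.comp x
        ((hφ.smooth.differentiable (by simp)) x).hasFDerivAt
      have h2 : fderiv ℝ (fun x ↦ φ x c) x = _ := h1.fderiv
      rw [partialD, h2]
      rfl
  have hcoord : ∀ (f : EuclideanSpace ℝ (Fin d) → ℝ) (g : EuclideanSpace ℝ (Fin d) → R3)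
      (c : Fin 3), IntegrableOn (fun x ↦ f x • g x) Ω →
      (∫ x in Ω, f x • g x) c = ∫ x in Ω, f x * g x c := fun f g c hfg ↦
    ((EuclideanSpace.proj (𝕜 := ℝ) c).integral_comp_comm hfg).symm
  have hcoordi : ∀ (f : EuclideanSpace ℝ (Fin d) → ℝ) (g : EuclideanSpace ℝ (Fin d) → R3)
      (c : Fin 3), IntegrableOn (fun x ↦ f x • g x) Ω →
      IntegrableOn (fun x ↦ f x * g x c) Ω := fun f g c hfg ↦
    (EuclideanSpace.proj (𝕜 := ℝ) c).integrable_comp hfg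
  have hGφ : ∀ k, ∫ x in Ω, inner ℝ (G k x) (partialD k φ x) =
      ∑ c, ∫ x in Ω, partialD k (fun x ↦ φ x c) x * G' k x c := fun k ↦ by
    rw [← integral_finsetSum _ fun c _ ↦
      hcoordi _ _ c ((hφc c).integrableOn_partialD_smul (hG'.locInt_grad k) k)]
    refine integral_congr_ae ?_
    filter_upwards [hG.ae_eq hΩ hG' k] with x hx
    simp [hx, hdc, PiLp.inner_apply]
  have hLφ : ∫ x in Ω, inner ℝ (L x) (φ x) = ∑ c, ∫ x in Ω, φ x c * L x c := by
    rw [← integral_finsetSum _ fun c _ ↦ hcoordi _ _ c ((hφc c).integrableOn_smul hLi)]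
    refine integral_congr_ae (Eventually.of_forall fun x ↦ ?_)
    simp [PiLp.inner_apply]
  simp only [hGφ]
  rw [hLφ, Finset.sum_comm, ← Finset.sum_add_distrib]
  refine Finset.sum_eq_zero fun c _ ↦ ?_
  have h1 := congrArg (EuclideanSpace.proj (𝕜 := ℝ) c) (hparts _ (hφc c))
  rw [map_sum, map_neg] at h1
  simp only [PiLp.proj_apply] at h1
  rw [hcoord _ _ c ((hφc c).integrableOn_smul hLi)] at h1
  simp only [fun k ↦ hcoord _ _ c ((hφc c).integrableOn_partialD_smul (hG'.locInt_grad k) k)] at h1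
  rw [h1, neg_add_cancel]

theorem tendsto_integral_inner {α : Type*} [MeasurableSpace α] {μ : Measure α} {f g : α → R3}
    {φ : ℕ → α → R3} (hf : MemLp f 2 μ) (hg : MemLp g 2 μ) (hφ : ∀ n, MemLp (φ n) 2 μ)
    (h : Tendsto (fun n ↦ eLpNorm (φ n - g) 2 μ) atTop (𝓝 0)) :
    Tendsto (fun n ↦ ∫ x, inner ℝ (f x) (φ n x) ∂μ) atTop (𝓝 (∫ x, inner ℝ (f x) (g x) ∂μ)) := by
  have h1 : Tendsto (fun n ↦ (hφ n).toLp (φ n)) atTop (𝓝 (hg.toLp g)) :=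
    (Lp.tendsto_Lp_iff_tendsto_eLpNorm'' φ hφ g hg).2 h
  simp only [← inner_toLp_toLp hf hg, ← fun n ↦ inner_toLp_toLp hf (hφ n)]
  exact tendsto_const_nhds.inner h1

/-- Green's formula against functions in `H¹₀`. -/
theorem IsWeakLaplacian.parts_memH10 (hΩ : IsOpen Ω) (hL : IsWeakLaplacian Ω u L)
    (hL2 : MemLp L 2 (volume.restrict Ω)) (hG : IsWeakGrad Ω u G)
    (hG2 : ∀ k, MemLp (G k) 2 (volume.restrict Ω)) (hv : MemH10 Ω v) (hH : IsWeakGrad Ω v H) :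
    (∑ k, ∫ x in Ω, inner ℝ (G k x) (H k x)) + ∫ x in Ω, inner ℝ (L x) (v x) = 0 := by
  obtain ⟨hv2, H', hH', hH2, φ, hφ, hφv, hφH⟩ := hv
  have hmem : ∀ (f : EuclideanSpace ℝ (Fin d) → R3), Continuous f → HasCompactSupport f →
      MemLp f 2 (volume.restrict Ω) := fun f hf hfc ↦
    (hf.memLp_of_hasCompactSupport hfc).restrict Ω
  have h1 : Tendsto (fun n ↦ (∑ k, ∫ x in Ω, inner ℝ (G k x) (partialD k (φ n) x)) +
      ∫ x in Ω, inner ℝ (L x) (φ n x)) atTop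
      (𝓝 ((∑ k, ∫ x in Ω, inner ℝ (G k x) (H' k x)) + ∫ x in Ω, inner ℝ (L x) (v x))) := by
    refine (tendsto_finsetSum _ fun k _ ↦ ?_).add ?_
    · exact tendsto_integral_inner (hG2 k) (hH2 k) (fun n ↦ hmem _ ((hφ n).continuous_partialD k)
        ((hφ n).compact.fderiv_apply ℝ _)) (hφH k)
    · exact tendsto_integral_inner hL2 hv2
        (fun n ↦ hmem _ (hφ n).smooth.continuous (hφ n).compact) hφv
  simp only [fun n ↦ hL.parts_testFunction hΩ hG (hφ n)] at h1
  have h2 := tendsto_nhds_unique h1 tendsto_const_nhds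
  rw [← h2]
  congr 1
  refine Finset.sum_congr rfl fun k _ ↦ integral_congr_ae ?_
  filter_upwards [hH.ae_eq hΩ hH' k] with x hx
  rw [hx]

end WeakGradient

/-! ### Normalization onto the sphere -/

section Projection

variable {d : ℕ} {Ω : Set (EuclideanSpace ℝ (Fin d))} {u : EuclideanSpace ℝ (Fin d) → R3}
  {G : Fin d → EuclideanSpace ℝ (Fin d) → R3}

/-- A smooth positive function on `ℝ` which equals `t` for `1 / 2 ≤ t`. -/
noncomputable def smoothedId (t : ℝ) : ℝ :=
  Real.smoothTransition (2 * t) * t + (1 - Real.smoothTransition (2 * t))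

theorem smoothedId_pos (t : ℝ) : 0 < smoothedId t := by
  rw [smoothedId]
  rcases le_or_gt t 0 with ht | ht
  · rw [Real.smoothTransition.zero_of_nonpos (by linarith)]
    norm_num
  · have h1 := Real.smoothTransition.nonneg (2 * t)
    rcases h1.eq_or_lt with h | h
    · rw [← h]
      norm_num
    · have h2 := Real.smoothTransition.le_one (2 * t)
      have := mul_pos h ht
      linarith

theorem smoothedId_eq {t : ℝ} (ht : 1 / 2 ≤ t) : smoothedId t = t := by
  rw [smoothedId, Real.smoothTransition.one_of_one_le (by linarith)]
  ring

theorem contDiff_smoothedId : ContDiff ℝ 1 smoothedId := by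
  have h : ContDiff ℝ 1 fun t : ℝ ↦ Real.smoothTransition (2 * t) :=
    Real.smoothTransition.contDiff.comp (contDiff_const.mul contDiff_id)
  exact (h.mul contDiff_id).add (contDiff_const.sub h)

/-- A smooth map which equals `x / |x|` for `1 / 2 ≤ |x|²`. -/
noncomputable def smoothProj (x : R3) : R3 := (√(smoothedId (‖x‖ ^ 2)))⁻¹ • x

theorem contDiff_smoothProj : ContDiff ℝ 1 smoothProj := by
  have h : ContDiff ℝ 1 fun x : R3 ↦ smoothedId (‖x‖ ^ 2) :=
    contDiff_smoothedId.comp (contDiff_norm_sq ℝ)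
  have h2 : ContDiff ℝ 1 fun x : R3 ↦ √(smoothedId (‖x‖ ^ 2)) :=
    h.sqrt fun x ↦ (smoothedId_pos _).ne'
  exact (h2.inv fun x ↦ (Real.sqrt_pos.2 (smoothedId_pos _)).ne').smul contDiff_id

theorem smoothProj_eq {x : R3} (hx : 1 / 2 ≤ ‖x‖ ^ 2) : smoothProj x = ‖x‖⁻¹ • x := by
  rw [smoothProj, smoothedId_eq hx, Real.sqrt_sq (norm_nonneg x)]

/-- The derivative of x/|x| is |x|⁻¹ times the orthogonal projection onto the complement of x. -/
theorem norm_fderiv_smoothProj_apply_le {x : R3} (hx : 1 ≤ ‖x‖) (y : R3) :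
    ‖fderiv ℝ smoothProj x y‖ ≤ ‖y‖ := by
  have hx0 : x ≠ 0 := norm_pos_iff.1 (by linarith)
  have hn : ‖x‖ ≠ 0 := by linarith
  -- The threshold 1/2 lies below 1, so the two maps agree near x even when |x| = 1.
  have heq : smoothProj =ᶠ[𝓝 x] fun z ↦ (√(‖z‖ ^ 2))⁻¹ • z := by
    have hc : Continuous fun z : R3 ↦ ‖z‖ ^ 2 := by fun_prop
    filter_upwards [hc.continuousAt.eventually (lt_mem_nhds (show (1 / 2 : ℝ) < ‖x‖ ^ 2 by nlinarith))] with z hz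
    rw [smoothProj_eq hz.le, Real.sqrt_sq (norm_nonneg z)]
  have h1 : HasFDerivAt (fun z : R3 ↦ ‖z‖ ^ 2) (2 • innerSL ℝ x) x :=
    (hasStrictFDerivAt_norm_sq x).hasFDerivAt
  have h2 := h1.sqrt (by positivity)
  have h3 := (hasDerivAt_inv (x := √(‖x‖ ^ 2)) (by rw [Real.sqrt_sq (norm_nonneg x)]; exact hn)).comp_hasFDerivAt x h2
  have h4 := h3.smul (hasFDerivAt_id x)
  have h5 : fderiv ℝ smoothProj x y = ‖x‖⁻¹ • y - (inner ℝ x y / ‖x‖ ^ 3) • x := by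
    rw [heq.fderiv_eq, show fderiv ℝ (fun z : R3 ↦ (√(‖z‖ ^ 2))⁻¹ • z) x = _ from h4.fderiv]
    simp [Real.sqrt_sq (norm_nonneg x)]
    rw [sub_eq_add_neg, ← neg_smul]
    congr 1
    field_simp
    rw [neg_smul]
  rw [h5]
  refine le_of_sq_le_sq ?_ (norm_nonneg y)
  have h6 : ‖‖x‖⁻¹ • y - (inner ℝ x y / ‖x‖ ^ 3) • x‖ ^ 2 =
      (‖y‖ ^ 2 - (inner ℝ x y / ‖x‖) ^ 2) / ‖x‖ ^ 2 := by
    rw [norm_sub_sq_real, norm_smul, norm_smul, real_inner_smul_left, real_inner_smul_right,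
      real_inner_comm x y, mul_pow, mul_pow, norm_inv, norm_norm, Real.norm_eq_abs, sq_abs]
    field_simp
    ring
  rw [h6, div_le_iff₀ (by positivity)]
  nlinarith [sq_nonneg (inner ℝ x y / ‖x‖), mul_nonneg (sq_nonneg ‖y‖)
    (show 0 ≤ ‖x‖ ^ 2 - 1 by nlinarith)]

/-- Compactness handles the unit ball, the preceding bound its exterior. The chain rule needs a
bound on all of ℝ³, hence the smooth modification near 0. -/
theorem exists_norm_fderiv_smoothProj_le : ∃ C, ∀ x, ‖fderiv ℝ smoothProj x‖ ≤ C := by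
  obtain ⟨C, hC⟩ := (isCompact_closedBall (0 : R3) 1).exists_bound_of_continuousOn
    (contDiff_smoothProj.continuous_fderiv one_ne_zero).continuousOn
  refine ⟨max C 1, fun x ↦ ?_⟩
  rcases le_total ‖x‖ 1 with h | h
  · exact (hC x (by simpa using h)).trans (le_max_left _ _)
  · refine (ContinuousLinearMap.opNorm_le_bound _ zero_le_one fun y ↦ ?_).trans (le_max_right _ _)
    rw [one_mul]
    exact norm_fderiv_smoothProj_apply_le h y

/-- Normalizing a field of length at least one does not increase the Dirichlet energy. -/
theorem dirichletEnergy_normalize_le (hΩ : IsOpen Ω) (hu : IsWeakGrad Ω u G)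
    (hG : ∀ k, MemLp (G k) 2 (volume.restrict Ω)) (hu1 : ∀ᵐ x ∂(volume.restrict Ω), 1 ≤ ‖u x‖)
    {v : EuclideanSpace ℝ (Fin d) → R3} (hv : ∀ᵐ x ∂(volume.restrict Ω), v x = ‖u x‖⁻¹ • u x) :
    HasFiniteDirichletEnergy Ω v ∧ dirichletEnergy Ω v ≤ dirichletEnergy Ω u := by
  obtain ⟨C, hC⟩ := exists_norm_fderiv_smoothProj_le
  have hw := hu.comp hΩ contDiff_smoothProj hC
  have hwv : (fun x ↦ smoothProj (u x)) =ᵐ[volume.restrict Ω] v := by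
    filter_upwards [hu1, hv] with x h1 h2
    rw [h2, smoothProj_eq (by nlinarith)]
  have hv' := hw.congr hwv
  have hle : ∀ k, ∀ᵐ x ∂(volume.restrict Ω),
      ‖fderiv ℝ smoothProj (u x) (G k x)‖ ≤ ‖G k x‖ := fun k ↦ by
    filter_upwards [hu1] with x hx
    exact norm_fderiv_smoothProj_apply_le hx _
  have hmem : ∀ k, MemLp (fun x ↦ fderiv ℝ smoothProj (u x) (G k x)) 2 (volume.restrict Ω) :=
    fun k ↦ (hG k).mono (aestronglyMeasurable_fderiv_apply contDiff_smoothProj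
      hu.locInt.aestronglyMeasurable (hG k).aestronglyMeasurable) (hle k)
  refine ⟨⟨_, hv', hmem⟩, ?_⟩
  rw [dirichletEnergy_eq hΩ hv', dirichletEnergy_eq hΩ hu]
  have hint : ∀ {K : Fin d → EuclideanSpace ℝ (Fin d) → R3},
      (∀ k, MemLp (K k) 2 (volume.restrict Ω)) →
      Integrable (fun x ↦ (1 / 2 : ℝ) * ∑ k, ‖K k x‖ ^ 2) (volume.restrict Ω) := fun hK ↦
    (integrable_finsetSum _ fun k _ ↦ (hK k).integrable_norm_pow (by norm_num)).const_mul _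
  refine integral_mono_ae (hint hmem) (hint hG) ?_
  filter_upwards [ae_all_iff.2 hle] with x hx
  gcongr with k
  exact hx k

end Projection

/-! ### Runge-Kutta norm identity -/

section Algebra

variable {ι H : Type*} [Fintype ι] [NormedAddCommGroup H] [InnerProductSpace ℝ H]

/-- The double sum is the value at the all-ones vector of the form of the Hadamard product of Q with
the Gram matrix of W, which is positive semidefinite by Schur's product theorem. -/
theorem Matrix.PosSemidef.sum_mul_inner_nonneg {Q : Matrix ι ι ℝ}
    (hQ : Q.PosSemidef) (W : ι → H) : 0 ≤ ∑ i, ∑ j, Q i j * inner ℝ (W i) (W j) := by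
  have h := (hQ.hadamard (Matrix.posSemidef_gram ℝ W)).dotProduct_mulVec_nonneg 1
  simpa [dotProduct, Matrix.mulVec, Matrix.gram_apply] using h

/-- Energy identity of a Runge-Kutta update `g₀ + τ ∑ bⱼ Wⱼ` with internal points
`pⱼ = g₀ + τ ∑ Mⱼₗ Wₗ`. -/
theorem norm_sq_add_smul_sum_eq [DecidableEq ι] (M : Matrix ι ι ℝ) (b : ι → ℝ) (τ : ℝ) (g₀ : H)
    (p W : ι → H) (hp : ∀ j, p j = g₀ + τ • ∑ l, M j l • W l) :
    ‖g₀ + τ • ∑ j, b j • W j‖ ^ 2 = ‖g₀‖ ^ 2 + 2 * τ * ∑ j, b j * inner ℝ (p j) (W j) -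
      τ ^ 2 * ∑ i, ∑ j, (Matrix.diagonal b * M + (Matrix.diagonal b * M).transpose -
        Matrix.vecMulVec b b) i j * inner ℝ (W i) (W j) := by
  have h1 : ∑ j, b j * inner ℝ (p j) (W j) = ∑ j, b j * inner ℝ g₀ (W j) +
      τ * ∑ i, ∑ j, b i * M i j * inner ℝ (W i) (W j) := by
    rw [Finset.mul_sum, ← Finset.sum_add_distrib]
    refine Finset.sum_congr rfl fun j _ ↦ ?_
    rw [hp, inner_add_left, real_inner_smul_left, sum_inner, mul_add]
    congr 1
    simp only [real_inner_smul_left, Finset.mul_sum]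
    refine Finset.sum_congr rfl fun l _ ↦ ?_
    rw [real_inner_comm (W j) (W l)]
    ring
  have h2 : ‖∑ j, b j • W j‖ ^ 2 = ∑ i, ∑ j, b i * b j * inner ℝ (W i) (W j) := by
    rw [← real_inner_self_eq_norm_sq, sum_inner]
    refine Finset.sum_congr rfl fun i _ ↦ ?_
    rw [inner_sum]
    refine Finset.sum_congr rfl fun j _ ↦ ?_
    rw [real_inner_smul_left, real_inner_smul_right]
    ring
  have h3 : ∑ i, ∑ j, b j * M j i * inner ℝ (W i) (W j) =
      ∑ i, ∑ j, b i * M i j * inner ℝ (W i) (W j) := by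
    rw [Finset.sum_comm]
    simp_rw [real_inner_comm]
  have h4 : ∑ i, ∑ j, (Matrix.diagonal b * M + (Matrix.diagonal b * M).transpose -
        Matrix.vecMulVec b b) i j * inner ℝ (W i) (W j) =
      2 * ∑ i, ∑ j, b i * M i j * inner ℝ (W i) (W j) - ‖∑ j, b j • W j‖ ^ 2 := by
    rw [h2, two_mul]
    nth_rewrite 2 [← h3]
    rw [← Finset.sum_add_distrib, ← Finset.sum_sub_distrib]
    refine Finset.sum_congr rfl fun i _ ↦ ?_
    rw [← Finset.sum_add_distrib, ← Finset.sum_sub_distrib]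
    refine Finset.sum_congr rfl fun j _ ↦ ?_
    simp only [Matrix.sub_apply, Matrix.add_apply, Matrix.transpose_apply,
      Matrix.diagonal_mul, Matrix.vecMulVec_apply]
    ring
  rw [h4, h1, norm_add_sq_real, real_inner_smul_right, norm_smul, mul_pow, inner_sum,
    Real.norm_eq_abs, sq_abs]
  simp only [real_inner_smul_right]
  ring

variable {s : ℕ} {A D : Matrix (Fin s) (Fin s) ℝ} {b : Fin s → ℝ} {τ : ℝ}

theorem sum_Iic_smul_eq {V : Type*} [AddCommGroup V] [Module ℝ V]
    (hA : ∀ i j, i < j → A i j = 0) (i : Fin s) (W : Fin s → V) :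
    ∑ j ∈ Finset.Iic i, A i j • W j = ∑ j, A i j • W j := by
  refine Finset.sum_subset (Finset.subset_univ _) fun j _ hj ↦ ?_
  rw [hA i j (by simpa using hj), zero_smul]

/-- Energy stability of the update: the algebraic core. -/
theorem norm_sq_update_le (hAD : IsPRKTableau A D) (hb : ∀ i, 0 ≤ b i)
    (hQ : (matQ A D b).PosSemidef) (hτ : 0 < τ) {g₀ : H} {g W : Fin s → H}
    (hg : ∀ i, g i = g₀ + τ • ∑ j, A i j • W j)
    (hW : ∀ j, inner ℝ (∑ k, D j k • g k) (W j) ≤ 0) :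
    ‖g₀ + τ • ∑ j, b j • W j‖ ^ 2 ≤ ‖g₀‖ ^ 2 := by
  -- The rows of D sum to one, so averaging the stages leaves g₀ unchanged.
  have hp : ∀ j, ∑ k, D j k • g k = g₀ + τ • ∑ l, (D * A) j l • W l := fun j ↦ by
    simp only [hg, smul_add, Finset.sum_add_distrib, ← Finset.sum_smul, hAD.rowD, one_smul,
      Matrix.mul_apply]
    congr 1
    simp only [Finset.sum_smul, Finset.smul_sum, smul_smul]
    rw [Finset.sum_comm]
    refine Finset.sum_congr rfl fun i _ ↦ Finset.sum_congr rfl fun j _ ↦ ?_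
    ring_nf
  have hid := norm_sq_add_smul_sum_eq (D * A) b τ g₀ _ W hp
  have hpos := hQ.sum_mul_inner_nonneg W
  rw [matQ, Matrix.mul_assoc] at hpos
  rw [hid]
  have : ∑ j, b j * inner ℝ (∑ k, D j k • g k) (W j) ≤ 0 :=
    Finset.sum_nonpos fun j _ ↦ mul_nonpos_of_nonneg_of_nonpos (hb j) (hW j)
  nlinarith [mul_nonneg (sq_nonneg τ) hpos, mul_nonneg hτ.le (neg_nonneg.2 this)]

/-- The length does not decrease in the update: the algebraic core. -/
theorem norm_sq_le_norm_sq_update (hR : (matR A b).PosSemidef) {u : Fin (s + 1) → H}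
    {w : Fin s → H} (hu : ∀ i : Fin s, u i.succ = u 0 + τ • ∑ j, A i j • w j)
    (hw : ∀ j : Fin s, inner ℝ (u j.castSucc) (w j) = 0) :
    ‖u 0‖ ^ 2 ≤ ‖u 0 + τ • ∑ j, b j • w j‖ ^ 2 := by
  -- The zero first row of JA yields u₀; row n + 1 of JA is row n of A, which yields the previous
  -- stage.
  have hp : ∀ j : Fin s, u j.castSucc = u 0 + τ • ∑ l, (shiftJ s * A) j l • w l := fun j ↦ by
    obtain ⟨n, hn⟩ := j
    rcases n with _ | n
    · simp [Matrix.mul_apply, shiftJ]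
    · have h1 : ∀ l, (shiftJ s * A) ⟨n + 1, hn⟩ l = A ⟨n, by omega⟩ l := fun l ↦ by
        rw [Matrix.mul_apply, Finset.sum_eq_single ⟨n, by omega⟩]
        · simp [shiftJ]
        · intro i _ hi
          have : n ≠ i := fun h ↦ hi (Fin.ext h.symm)
          simp [shiftJ, this]
        · simp
      simp only [h1]
      exact hu ⟨n, by omega⟩
  have hid := norm_sq_add_smul_sum_eq (shiftJ s * A) b τ (u 0) _ w hp
  have hpos := hR.sum_mul_inner_nonneg w
  have hneg : ∀ i j, (Matrix.diagonal b * (shiftJ s * A) +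
      (Matrix.diagonal b * (shiftJ s * A)).transpose - Matrix.vecMulVec b b) i j =
      -matR A b i j := fun i j ↦ by
    simp only [matR, Matrix.mul_assoc, Matrix.sub_apply, Matrix.add_apply]
    ring
  simp only [hneg, neg_mul, Finset.sum_neg_distrib, hw, mul_zero, Finset.sum_const_zero] at hid
  rw [hid]
  nlinarith [mul_nonneg (sq_nonneg τ) hpos]

end Algebra

/-! ### Orthogonality and dissipativity of P -/

section Projector

theorem inner_toLp_crossProduct_eq_zero (m v : R3) :
    inner ℝ m (WithLp.toLp 2 (crossProduct m.ofLp v.ofLp)) = 0 ∧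
      inner ℝ v (WithLp.toLp 2 (crossProduct m.ofLp v.ofLp)) = 0 := by
  constructor <;>
  · simp [PiLp.inner_apply, Fin.sum_univ_three, cross_apply]
    ring

/-- Both v - (m·v)m/|m|² and m × v are orthogonal to m; for m = 0 there is nothing to prove. -/
theorem inner_opP_self (α β : ℝ) (m v : R3) : inner ℝ m (opP α β m v) = 0 := by
  rw [opP, inner_add_right, real_inner_smul_right, real_inner_smul_right,
    (inner_toLp_crossProduct_eq_zero m v).1, inner_sub_right, real_inner_smul_right,
    real_inner_self_eq_norm_sq]
  rcases eq_or_ne m 0 with rfl | hm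
  · simp
  · have : ‖m‖ ≠ 0 := norm_ne_zero_iff.2 hm
    field_simp
    simp

/-- The cross product drops out and the rest is Cauchy-Schwarz; at m = 0 the value is α|v|². -/
theorem inner_opP_nonneg {α : ℝ} (hα : 0 < α) (β : ℝ) (m v : R3) :
    0 ≤ inner ℝ v (opP α β m v) := by
  rw [opP, inner_add_right, real_inner_smul_right, real_inner_smul_right,
    (inner_toLp_crossProduct_eq_zero m v).2, inner_sub_right, real_inner_smul_right,
    real_inner_self_eq_norm_sq, mul_zero, add_zero]
  refine mul_nonneg hα.le ?_
  rcases eq_or_ne m 0 with rfl | hm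
  · simp
  · have h1 : 0 < ‖m‖ ^ 2 := by positivity
    have h2 := abs_real_inner_le_norm m v
    have h3 : (inner ℝ m v) ^ 2 ≤ ‖m‖ ^ 2 * ‖v‖ ^ 2 := by
      rw [← mul_pow, ← sq_abs]
      gcongr
    rw [real_inner_comm m v, sub_nonneg, div_mul_eq_mul_div, div_le_iff₀ h1]
    linarith

end Projector

/-! ### Energy decay of the predictor -/

section Update

variable {d : ℕ} {Ω : Set (EuclideanSpace ℝ (Fin d))}

theorem gradToLp_add {G H : Fin d → EuclideanSpace ℝ (Fin d) → R3}
    (hG : ∀ k, MemLp (G k) 2 (volume.restrict Ω)) (hH : ∀ k, MemLp (H k) 2 (volume.restrict Ω))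
    (h : ∀ k, MemLp ((G + H) k) 2 (volume.restrict Ω)) :
    gradToLp h = gradToLp hG + gradToLp hH :=
  rfl

theorem gradToLp_const_smul {G : Fin d → EuclideanSpace ℝ (Fin d) → R3}
    (hG : ∀ k, MemLp (G k) 2 (volume.restrict Ω)) (c : ℝ)
    (h : ∀ k, MemLp ((c • G) k) 2 (volume.restrict Ω)) :
    gradToLp h = c • gradToLp hG :=
  rfl

theorem gradToLp_congr {G H : Fin d → EuclideanSpace ℝ (Fin d) → R3}
    (hG : ∀ k, MemLp (G k) 2 (volume.restrict Ω)) (hH : ∀ k, MemLp (H k) 2 (volume.restrict Ω))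
    (h : G = H) : gradToLp hG = gradToLp hH := by
  subst h
  rfl

theorem gradToLp_sum {ι : Type*} (s : Finset ι) {G : ι → Fin d → EuclideanSpace ℝ (Fin d) → R3}
    (hG : ∀ i k, MemLp (G i k) 2 (volume.restrict Ω))
    (h : ∀ k, MemLp ((∑ i ∈ s, G i) k) 2 (volume.restrict Ω)) :
    gradToLp h = ∑ i ∈ s, gradToLp (hG i) := by
  classical
  induction s using Finset.induction_on with
  | empty => rfl
  | insert i s hi ih =>
    have h' : ∀ k, MemLp ((∑ i ∈ s, G i) k) 2 (volume.restrict Ω) := fun k ↦ by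
      rw [Finset.sum_apply]
      exact memLp_finsetSum' s fun i _ ↦ hG i k
    rw [Finset.sum_insert (f := fun i ↦ gradToLp (hG i)) hi, ← ih h',
      ← gradToLp_add (hG i) h' fun k ↦ (hG i k).add (h' k)]
    exact gradToLp_congr _ _ (Finset.sum_insert hi)

theorem integrable_inner_of_memLp {X : Type*} [MeasurableSpace X] {μ : Measure X} {f g : X → R3}
    (hf : MemLp f 2 μ) (hg : MemLp g 2 μ) : Integrable (fun x ↦ inner ℝ (f x) (g x)) μ := by
  refine (L2.integrable_inner (𝕜 := ℝ) (hf.toLp f) (hg.toLp g)).congr ?_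
  filter_upwards [hf.coeFn_toLp, hg.coeFn_toLp] with x h1 h2
  rw [h1, h2]

theorem IsPRKTableau.inv_mul_self {s : ℕ} {A D : Matrix (Fin s) (Fin s) ℝ}
    (h : IsPRKTableau A D) : A⁻¹ * A = 1 ∧ A * A⁻¹ = 1 := by
  have hdet : IsUnit A.det := by
    rw [Matrix.det_of_isLowerTriangular A fun i j hij ↦ h.lowerA i j hij]
    exact (Finset.prod_pos fun i _ ↦ h.diagA i).ne'.isUnit
  exact ⟨Matrix.nonsing_inv_mul A hdet, Matrix.mul_nonsing_inv A hdet⟩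

theorem sum_smul_sum_smul_of_mul_eq_one {ι V : Type*} [Fintype ι] [DecidableEq ι]
    [AddCommGroup V] [Module ℝ V] {A C : Matrix ι ι ℝ} (h : A * C = 1) (w : ι → V) (i : ι) :
    ∑ j, A i j • ∑ l, C j l • w l = w i := by
  simp only [Finset.smul_sum, smul_smul]
  rw [Finset.sum_comm]
  simp only [← Finset.sum_smul, ← Matrix.mul_apply, h, Matrix.one_apply, ite_smul, one_smul,
    zero_smul, Finset.sum_ite_eq, Finset.mem_univ, if_true]

theorem smul_sum_smul_inv_smul {ι V : Type*} [Fintype ι] [AddCommGroup V] [Module ℝ V] {τ : ℝ}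
    (hτ : τ ≠ 0) (f : ι → ℝ) (w : ι → V) : τ • ∑ j, f j • (τ⁻¹ • w j) = ∑ j, f j • w j := by
  rw [Finset.smul_sum]
  refine Finset.sum_congr rfl fun j _ ↦ ?_
  rw [smul_comm (f j), smul_inv_smul₀ hτ]

variable {s : ℕ} {bc : BoundaryCondition} {α β τ : ℝ} {A D : Matrix (Fin s) (Fin s) ℝ}
  {b : Fin s → ℝ} {m mt m' : EuclideanSpace ℝ (Fin d) → R3}
  {u : Fin (s + 1) → EuclideanSpace ℝ (Fin d) → R3} {L : Fin s → EuclideanSpace ℝ (Fin d) → R3}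

/-- Green's formula for the stages against stage increments. -/
theorem IsPRKStep.green (hΩ : IsOpen Ω) (h : IsPRKStep Ω bc α β τ A D b m u L mt m')
    {G H : Fin d → EuclideanSpace ℝ (Fin d) → R3} (i j : Fin s)
    (hG : IsWeakGrad Ω (u i.succ) G) (hG2 : ∀ k, MemLp (G k) 2 (volume.restrict Ω))
    (hH : IsWeakGrad Ω (u j.succ - m) H) (hH2 : ∀ k, MemLp (H k) 2 (volume.restrict Ω)) :
    (∑ k, ∫ x in Ω, inner ℝ (G k x) (H k x)) +
      ∫ x in Ω, inner ℝ (L i x) ((u j.succ - m) x) = 0 := by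
  rcases bc with _ | _
  · exact (h.laplacian i).parts_memH10 hΩ (h.laplacian_memLp i) hG hG2
      (h.boundary_dirichlet rfl j) hH
  · obtain ⟨G', hG', -, hparts⟩ := h.boundary_neumann rfl i
    rw [← hparts _ H (h.memH1 j).1 hH hH2]
    congr 1
    refine Finset.sum_congr rfl fun k _ ↦ integral_congr_ae ?_
    filter_upwards [hG.ae_eq hΩ hG' k] with x hx
    rw [hx]

/-- Inverting the stage equations trades the nonlinear slopes for increments, which have weak
gradients and satisfy the boundary condition needed in Green's formula. -/
theorem IsPRKStep.slope_eq (h : IsPRKStep Ω bc α β τ A D b m u L mt m')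
    (hAD : IsPRKTableau A D) : ∀ᵐ x ∂(volume.restrict Ω), ∀ j,
      τ • prkSlope α β D u L j x = ∑ i, A⁻¹ j i • (u i.succ - m) x := by
  filter_upwards [ae_all_iff.2 h.stage] with x hx j
  have h1 : ∀ i, (u i.succ - m) x = ∑ j, A i j • (τ • prkSlope α β D u L j x) := fun i ↦ by
    rw [Pi.sub_apply, hx i, h.init, add_sub_cancel_left, sum_Iic_smul_eq hAD.lowerA,
      Finset.smul_sum]
    exact Finset.sum_congr rfl fun j _ ↦ smul_comm _ _ _
  simp only [h1]
  exact (sum_smul_sum_smul_of_mul_eq_one hAD.inv_mul_self.1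
    (fun j ↦ τ • prkSlope α β D u L j x) j).symm

theorem IsPRKStep.one_le_norm (h : IsPRKStep Ω bc α β τ A D b m u L mt m')
    (hAD : IsPRKTableau A D) (hR : (matR A b).PosSemidef)
    (hm : ∀ᵐ x ∂(volume.restrict Ω), ‖m x‖ = 1) : ∀ᵐ x ∂(volume.restrict Ω), 1 ≤ ‖mt x‖ := by
  filter_upwards [ae_all_iff.2 h.stage, h.predictor, hm] with x h1 h2 h3
  have h4 := norm_sq_le_norm_sq_update (b := b) (τ := τ) hR (u := fun i ↦ u i x)
    (w := fun j ↦ prkSlope α β D u L j x)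
    (fun i ↦ by rw [h1 i, sum_Iic_smul_eq hAD.lowerA]) fun j ↦ inner_opP_self _ _ _ _
  rw [← h2, h.init, h3] at h4
  nlinarith [norm_nonneg (mt x)]

/-- The sum is ∫ v · τP(uⱼ₋₁)v with v = ∑ₖ dⱼₖΔuₖ. Each term is integrable because increments,
unlike m when Ω has infinite measure, lie in L². -/
theorem IsPRKStep.sum_mul_integral_inner_nonneg
    (h : IsPRKStep Ω bc α β τ A D b m u L mt m') (hAD : IsPRKTableau A D) (hα : 0 < α)
    (hτ : 0 < τ) (j : Fin s) :
    0 ≤ ∑ k, ∑ i, D j k * A⁻¹ j i * ∫ x in Ω, inner ℝ (L k x) ((u i.succ - m) x) := by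
  have hint : ∀ k i, Integrable (fun x ↦ D j k * A⁻¹ j i * inner ℝ (L k x) ((u i.succ - m) x))
      (volume.restrict Ω) := fun k i ↦
    ((integrable_inner_of_memLp (h.laplacian_memLp k) (h.memH1 i).1)).const_mul _
  simp only [← integral_const_mul]
  simp_rw [← fun k ↦ integral_finsetSum Finset.univ fun i _ ↦ hint k i]
  rw [← integral_finsetSum _ fun k _ ↦ integrable_finsetSum _ fun i _ ↦ hint k i]
  refine integral_nonneg_of_ae ?_
  filter_upwards [h.slope_eq hAD] with x hx
  have h1 : ∑ k, ∑ i, D j k * A⁻¹ j i * inner ℝ (L k x) ((u i.succ - m) x) =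
      inner ℝ (∑ k, D j k • L k x) (τ • prkSlope α β D u L j x) := by
    rw [hx j, sum_inner]
    refine Finset.sum_congr rfl fun k _ ↦ ?_
    rw [inner_sum]
    refine Finset.sum_congr rfl fun i _ ↦ ?_
    rw [real_inner_smul_left, real_inner_smul_right]
    ring
  rw [h1, real_inner_smul_right, prkSlope, sum_Iic_smul_eq hAD.lowerD]
  exact mul_nonneg hτ.le (inner_opP_nonneg hα _ _ _)

/-- The Dirichlet energy does not increase before projection. -/
theorem IsPRKStep.exists_weakGrad_predictor (hΩ : IsOpen Ω)
    (h : IsPRKStep Ω bc α β τ A D b m u L mt m') (hAD : IsPRKTableau A D) (hα : 0 < α)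
    (hτ : 0 < τ) (hb : ∀ i, 0 ≤ b i) (hQ : (matQ A D b).PosSemidef)
    (hm : HasFiniteDirichletEnergy Ω m) :
    ∃ G, IsWeakGrad Ω mt G ∧ (∀ k, MemLp (G k) 2 (volume.restrict Ω)) ∧
      dirichletEnergy Ω mt ≤ dirichletEnergy Ω m := by
  obtain ⟨Gm, hGm, hGm2⟩ := hm
  choose Gd hGd hGd2 using fun i ↦ (h.memH1 i).2
  have hGs : ∀ i : Fin s, IsWeakGrad Ω (u i.succ) (Gm + Gd i) := fun i ↦ by
    simpa using hGm.add (hGd i)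
  have hGs2 : ∀ i k, MemLp ((Gm + Gd i) k) 2 (volume.restrict Ω) := fun i k ↦
    (hGm2 k).add (hGd2 i k)
  -- Coefficients Aᵀ⁻¹b that express m̃ - m through the stage increments.
  set c : Fin s → ℝ := fun i ↦ ∑ j, b j * A⁻¹ j i with hc
  have hcs2 : ∀ i k, MemLp ((c i • Gd i) k) 2 (volume.restrict Ω) := fun i k ↦
    (hGd2 i k).const_smul (c i)
  have hsum2 : ∀ k, MemLp ((∑ i, c i • Gd i) k) 2 (volume.restrict Ω) := fun k ↦ by
    rw [Finset.sum_apply]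
    exact memLp_finsetSum' _ fun i _ ↦ hcs2 i k
  have hGt2 : ∀ k, MemLp ((Gm + ∑ i, c i • Gd i) k) 2 (volume.restrict Ω) := fun k ↦
    (hGm2 k).add (hsum2 k)
  have hcomb : ∀ {V : Type} [AddCommGroup V] [Module ℝ V] (v : Fin s → V),
      ∑ j, b j • ∑ i, A⁻¹ j i • v i = ∑ i, c i • v i := fun v ↦ by
    simp only [Finset.smul_sum, smul_smul]
    rw [Finset.sum_comm]
    simp only [hc, Finset.sum_smul]
  have hmt : m + ∑ i, c i • (u i.succ - m) =ᵐ[volume.restrict Ω] mt := by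
    filter_upwards [h.predictor, h.slope_eq hAD] with x h1 h2
    rw [h1, h.init, Finset.smul_sum]
    simp only [smul_comm τ, h2, hcomb]
    simp
  have hGt := (hGm.add (IsWeakGrad.sum Finset.univ fun i ↦ (hGd i).const_smul (c i))).congr hmt
  refine ⟨_, hGt, hGt2, ?_⟩
  rw [dirichletEnergy_eq_norm_sq hΩ hGt hGt2, dirichletEnergy_eq_norm_sq hΩ hGm hGm2]
  -- The vectors τ⁻¹ ∑ᵢ A⁻¹ⱼᵢ ∇(uᵢ - m) serve as gradients of the slopes, so that predictor and
  -- stages take the form required by `norm_sq_update_le`.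
  have hgrad : gradToLp hGt2 = gradToLp hGm2 +
      τ • ∑ j, b j • (τ⁻¹ • ∑ i, A⁻¹ j i • gradToLp (hGd2 i)) := by
    rw [gradToLp_add hGm2 hsum2, gradToLp_sum _ hcs2]
    congr 1
    rw [smul_sum_smul_inv_smul hτ.ne', hcomb]
    exact Finset.sum_congr rfl fun i _ ↦ gradToLp_const_smul (hGd2 i) _ _
  rw [hgrad]
  have hstage : ∀ i, gradToLp (hGs2 i) = gradToLp hGm2 +
      τ • ∑ j, A i j • (τ⁻¹ • ∑ i, A⁻¹ j i • gradToLp (hGd2 i)) := fun i ↦ by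
    rw [gradToLp_add hGm2 (hGd2 i)]
    congr 1
    rw [smul_sum_smul_inv_smul hτ.ne']
    exact (sum_smul_sum_smul_of_mul_eq_one hAD.inv_mul_self.2
      (fun i ↦ gradToLp (hGd2 i)) i).symm
  refine mul_le_mul_of_nonneg_left (norm_sq_update_le hAD hb hQ hτ hstage fun j ↦ ?_)
    (by norm_num)
  have hpair : ∀ k i, inner ℝ (gradToLp (hGs2 k)) (gradToLp (hGd2 i)) =
      -∫ x in Ω, inner ℝ (L k x) ((u i.succ - m) x) := fun k i ↦ by
    rw [inner_gradToLp]
    exact eq_neg_of_add_eq_zero_left (h.green hΩ k i (hGs k) (hGs2 k) (hGd i) (hGd2 i))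
  have hexp : inner ℝ (∑ k, D j k • gradToLp (hGs2 k))
      (τ⁻¹ • ∑ i, A⁻¹ j i • gradToLp (hGd2 i)) =
      -(τ⁻¹ * ∑ k, ∑ i, D j k * A⁻¹ j i * ∫ x in Ω, inner ℝ (L k x) ((u i.succ - m) x)) := by
    rw [real_inner_smul_right, ← mul_neg, sum_inner, ← Finset.sum_neg_distrib]
    congr 1
    refine Finset.sum_congr rfl fun k _ ↦ ?_
    rw [inner_sum, ← Finset.sum_neg_distrib]
    refine Finset.sum_congr rfl fun i _ ↦ ?_
    rw [real_inner_smul_left, real_inner_smul_right, hpair]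
    ring
  rw [hexp, neg_nonpos]
  exact mul_nonneg (inv_nonneg.2 hτ.le) (h.sum_mul_integral_inner_nonneg hAD hα hτ j)

end Update

/-! ### Predictor and projection combined -/

theorem mainTheorem2 {d s : ℕ} (Ω : Set (EuclideanSpace ℝ (Fin d))) (hΩ : IsOpen Ω)
    (bc : BoundaryCondition) (α β τ : ℝ) (hα : 0 < α) (hτ : 0 < τ)
    (A D : Matrix (Fin s) (Fin s) ℝ) (b : Fin s → ℝ) (hAD : IsPRKTableau A D)
    (hb : ∀ i, 0 ≤ b i) (hQ : (matQ A D b).PosSemidef) (hR : (matR A b).PosSemidef)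
    (m : EuclideanSpace ℝ (Fin d) → R3) (hm : HasFiniteDirichletEnergy Ω m)
    (hm1 : ∀ᵐ x ∂(MeasureTheory.volume.restrict Ω), ‖m x‖ = 1)
    (u : Fin (s + 1) → EuclideanSpace ℝ (Fin d) → R3)
    (L : Fin s → EuclideanSpace ℝ (Fin d) → R3)
    (mt m' : EuclideanSpace ℝ (Fin d) → R3)
    (hstep : IsPRKStep Ω bc α β τ A D b m u L mt m') :
    (∀ᵐ x ∂(MeasureTheory.volume.restrict Ω), ‖m' x‖ = 1) ∧
    HasFiniteDirichletEnergy Ω m' ∧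
    dirichletEnergy Ω m' ≤ dirichletEnergy Ω m ∧
    (∀ᵐ x ∂(MeasureTheory.volume.restrict Ω), 1 ≤ ‖mt x‖) ∧
    HasFiniteDirichletEnergy Ω mt ∧
    dirichletEnergy Ω mt ≤ dirichletEnergy Ω m := by
  obtain ⟨G, hG, hG2, hE⟩ := hstep.exists_weakGrad_predictor hΩ hAD hα hτ hb hQ hm
  have hmt1 := hstep.one_le_norm hAD hR hm1
  obtain ⟨hm', hE'⟩ := dirichletEnergy_normalize_le hΩ hG hG2 hmt1 hstep.projection
  refine ⟨?_, hm', hE'.trans hE, hmt1, ⟨G, hG, hG2⟩, hE⟩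
  filter_upwards [hmt1, hstep.projection] with x h1 h2
  rw [h2, norm_smul, norm_inv, norm_norm, inv_mul_cancel₀ (by linarith)]
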